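/- **Setting.** Let $\mathcal X,\mathcal Y,\mathcal A,\mathcal B,\mathcal C$ be finite sets, with output sets $\mathcal A_x\subseteq\mathcal A$ and $\mathcal B_y\subseteq\mathcal B$, a probability distribution $P(x,y,t)$ on $\mathcal X\times\mathcal Y\times\{0,1\}$, a function $\bar c=f(a,b,x,y,t)\in\mathcal C$ (the test data), and a set $S_\Omega$ of probability distributions on $\mathcal C$. For POVMs $\{M_{a|x}\}_{a\in\mathcal A_x}$ on $Q_A$ and $\{N_{b|y}\}_{b\in\mathcal B_y}$ on $Q_B$ (finite-dimensional systems) and a normalized state $\sigma$ on $Q_AQ_BE$, with $E$ finite-dimensional, put $$\mathcal M(\sigma)_{A\bar CXYTE}=\sum_{x,y,t}P(x,y,t)\sum_{a,b}|a,\bar c\rangle\langle a,\bar c|\otimes|x,y,t\rangle\langle x,y,t|\otimes\operatorname{Tr}_{Q_AQ_B}[(M_{a|x}\otimes N_{b|y}\otimes 1_E)\sigma],\qquad \bar c=f(a,b,x,y,t).$$ Let $\mathcal M(\sigma)_{AXYTE\wedge\bar c}$ be its block at $\bar C=\bar c$, let $\mathcal M(\sigma)_{XYTE}$ be its marginal,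 and let $$p(\bar c)=\operatorname{Tr}\big[\mathcal M(\sigma)_{AXYTE\wedge\bar c}^{\alpha}\,(1_A\otimes\mathcal M(\sigma)_{XYTE})^{1-\alpha}\big]$$ (negative powers are those of the pseudo-inverse). For a probability distribution $q$ and a real function $g$ on $\mathcal C$ put $D(q\|g)=\sum_{\bar c}q(\bar c)\log_2\frac{q(\bar c)}{g(\bar c)}$, where a term with $q(\bar c)=0\le g(\bar c)$ is $0$, and a term with $g(\bar c)<0$ or $g(\bar c)=0<q(\bar c)$ is $+\infty$. **Polynomials.** Let $\alpha\in(1,2)$ and $m\ge1$, and let $t_1<\dots<t_m=1$ in $(0,1]$ and $w_1,\dots,w_m>0$ be the nodes and weights of the $m$-point Gauss–Radau quadrature on $[0,1]$ for the weight $s^{\alpha-1}(1-s)^{1-\alpha}$ with fixed node $1$ (exact on polynomials of degree at most $2m-2$). In noncommuting variables $M_{a|x}=M_{a|x}^\dagger$, $N_{b|y}=N_{b|y}^\dagger$, $Z^{x,y,t}_{\bar c,a,i}$, $Z^{x,y,t\,\dagger}_{\bar c,a,i}$ let $$\Pi_{\bar c}=\sum_{x,y,t}P(x,y,t)\sum_{a}\Big(\sum_{b}M_{a|x}N_{b|y}\Big[1+\tfrac{\sin\alpha\pi}{\pi}\sum_{i=1}^m\tfrac{w_i}{t_i}\big(1+Z_i+Z_i^\dagger+(1-t_i)Z_i^\dagger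 Z_i\big)\Big]+\tfrac{\sin\alpha\pi}{\pi}\sum_{i=1}^m w_iZ_iZ_i^\dagger\Big),$$ where $Z_i=Z^{x,y,t}_{\bar c,a,i}$, the sum over $b$ is over $b\in\mathcal B_y$ with $f(a,b,x,y,t)=\bar c$, and the sum over $a$ is over those $a\in\mathcal A_x$ for which such a $b$ exists. The constraints are $M_{a|x}\succeq0$, $N_{b|y}\succeq0$, $\sum_{a\in\mathcal A_x}M_{a|x}=1=\sum_{b\in\mathcal B_y}N_{b|y}$, and that all $M_{a|x}$ commute with all $N_{b|y}$ and that both commute with all $Z$ and $Z^\dagger$. **NPA relaxation.** An NPA relaxation has one real variable $y_v$ for each word $v$ of a finite set $V$ of words. For a polynomial $r$ supported in $V$ write $y(r)$ for the result of replacing each word $v$ by $y_v$. $M(y)$ is the block-diagonal matrix that consists of a moment matrix $(y(u^\dagger v))_{u,v\in W}$ for a finite set $W\ni1$ of words, of a localizing matrix $(y(u^\dagger g v))_{u,v\in W_g}$ for each $g\in\{M_{a|x}\}\cup\{N_{b|y}\}$ and a finite set $W_g$ of words, and of the entries $\pm y(r)$ for finitely many elements $r$ of the two-sided ideal generated by the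 equality constraints. All words that occur in these entries or in some $\Pi_{\bar c}$ lie in $V$. The sets are otherwise arbitrary. The variable of the empty word is called $y_1$, and $N=|V|$. **Theorem.** For all $\alpha\in(1,2)$ and $m\in\mathbb N$, $m\ge 1$, the quadrature above exists, and for every NPA relaxation with variables $\{y_i\}_{i=1}^N$ there are linear functions $f_{\bar c}(y)=\sum_{i=1}^Na_{i,\bar c}\,y_i$, namely $f_{\bar c}(y)=y(\Pi_{\bar c})$, such that the entries of $M(y)$ are linear in the $y_i$ and $$\inf_{Q_A,Q_B,E}\ \inf_{\{M_{a|x}\},\{N_{b|y}\}}\ \inf_{q\in S_\Omega}\ \inf_{\sigma\in S_=(Q_AQ_BE)}\ \frac1{\alpha-1}D(q\|p)\ \ \ge\ \ \inf\Big\{\frac1{\alpha-1}D(q\|f(y))\ :\ y_1=1,\ M(y)\succeq0,\ q\in S_\Omega\Big\}.$$ If $S_\Omega$ is convex, then the program on the right is convex (the epigraph of its objective on its feasible set is convex). -/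

import Mathlib

open scoped ComplexOrder Kronecker

noncomputable section

namespace DIRenyi

/-! ### Classical relative entropy -/

/-- One term `a log₂ (a / b)` of the relative entropy, for `a ≥ 0` and an arbitrary real `b`, with
the closed convention of convex optimization: `0 log (0 / b) = 0` for `b ≥ 0`, and the value `+∞`
where `b < 0`, or `b = 0 < a`. -/
def relEntTerm (a b : ℝ) : EReal :=
  if 0 < a ∧ 0 < b then ((a * Real.logb 2 (a / b) : ℝ) : EReal)
  else if a = 0 ∧ 0 ≤ b then 0
  else ⊤

/-- `D(q ‖ f) = ∑ q(c) log₂ (q(c) / f(c))`; the second argument need not be normalized. -/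
def relEnt {C : Type*} [Fintype C] (q f : C → ℝ) : EReal :=
  ∑ c, relEntTerm (q c) (f c)

/-! ### Gauss–Radau–Jacobi quadrature -/

/-- The `m`-point Gauss–Radau quadrature on `[0,1]` for the Jacobi weight
`t^(α-1) (1-t)^(1-α)` with the endpoint `1` as a node: the nodes lie in `(0,1]`, one of them is `1`,
the weights are positive, and the rule is exact on polynomials of degree at most `2m - 2`. (Nodes
are listed in increasing order, so that they and the weights are determined by `α` and `m ≥ 1`.) -/
structure IsGaussRadauJacobi (α : ℝ) (m : ℕ) (t w : Fin m → ℝ) : Prop where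
  strictMono : StrictMono t
  node_mem : ∀ i, t i ∈ Set.Ioc (0 : ℝ) 1
  endpoint : ∃ i, t i = 1
  weight_pos : ∀ i, 0 < w i
  exact : ∀ p : Polynomial ℝ, p.natDegree ≤ 2 * m - 2 →
    ∫ s in (0 : ℝ)..1, p.eval s * (s ^ (α - 1) * (1 - s) ^ (1 - α)) = ∑ i, w i * p.eval (t i)

/-! ### The protocol, the devices, and the single-round map -/

/-- The classical data of one round: the output sets `A_x` and `B_y` (subsets of common output
alphabets), the distribution `P(x,y,t)` of the inputs and of the test bit, and the function
`c = test (a,b,x,y,t)` that produces the test data. -/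
structure Protocol (X Y A B C : Type*) [Fintype X] [Fintype Y] where
  outA : X → Finset A
  outB : Y → Finset B
  prob : X → Y → Bool → ℝ
  prob_nonneg : ∀ x y t, 0 ≤ prob x y t
  prob_sum : ∑ x, ∑ y, ∑ t, prob x y t = 1
  test : A → B → X → Y → Bool → C

/-- A normalized quantum state. -/
def IsState {n : Type*} [Fintype n] (σ : Matrix n n ℂ) : Prop :=
  σ.PosSemidef ∧ σ.trace = 1

/-- The partial trace over the first tensor factor. -/
def trFst {m n : Type*} [Fintype m] (σ : Matrix (m × n) (m × n) ℂ) : Matrix n n ℂ :=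
  fun e e' => ∑ k, σ (k, e) (k, e')

/-- The real power `ρ^r` of a positive semidefinite matrix by functional calculus. As `0 ^ r = 0`
for `r ≠ 0`, a negative power is a power of the pseudo-inverse. -/
def mpow {n : Type*} [Fintype n] [DecidableEq n] (ρ : Matrix n n ℂ) (r : ℝ) : Matrix n n ℂ :=
  cfc (fun s : ℝ => s ^ r) ρ

section

variable {X Y A B C : Type*} [Fintype X] [Fintype Y] [Fintype A] [Fintype B] [Fintype C]
  [DecidableEq X] [DecidableEq Y] [DecidableEq A] [DecidableEq B] [DecidableEq C]

/-- Two families of POVMs: `{M_{a|x}}` on `Q_A = ℂ^dA` with outcomes in `A_x`, and `{N_{b|y}}` on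
`Q_B = ℂ^dB` with outcomes in `B_y`. -/
structure Device (S : Protocol X Y A B C) (dA dB : ℕ) where
  M : X → A → Matrix (Fin dA) (Fin dA) ℂ
  N : Y → B → Matrix (Fin dB) (Fin dB) ℂ
  M_pos : ∀ x a, (M x a).PosSemidef
  N_pos : ∀ y b, (N y b).PosSemidef
  M_sum : ∀ x, ∑ a ∈ S.outA x, M x a = 1
  N_sum : ∀ y, ∑ b ∈ S.outB y, N y b = 1
  M_zero : ∀ x a, a ∉ S.outA x → M x a = 0
  N_zero : ∀ y b, b ∉ S.outB y → N y b = 0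

/-- The index type of the joint system `Q_A Q_B E`. -/
abbrev Sys (dA dB dE : ℕ) : Type := (Fin dA × Fin dB) × Fin dE

variable {S : Protocol X Y A B C} {dA dB dE : ℕ}

/-- The block of `𝓜(σ)_{A C E | x,y,t}` at the classical values `a`, `c`:
`∑_{b : test(a,b,x,y,t) = c} Tr_{Q_A Q_B}[(M_{a|x} ⊗ N_{b|y} ⊗ 1_E) σ]`. -/
def Device.block (D : Device S dA dB) (σ : Matrix (Sys dA dB dE) (Sys dA dB dE) ℂ)
    (a : A) (c : C) (x : X) (y : Y) (t : Bool) : Matrix (Fin dE) (Fin dE) ℂ :=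
  ∑ b with S.test a b x y t = c,
    trFst (((D.M x a ⊗ₖ D.N y b) ⊗ₖ (1 : Matrix (Fin dE) (Fin dE) ℂ)) * σ)

/-- The output `𝓜(σ)_{A C X Y T E}` of the single-round map, block diagonal in the classical
registers `A, C, X, Y, T`. -/
def Device.out (D : Device S dA dB) (σ : Matrix (Sys dA dB dE) (Sys dA dB dE) ℂ) :
    Matrix (A × C × X × Y × Bool × Fin dE) (A × C × X × Y × Bool × Fin dE) ℂ :=
  fun (a, c, x, y, t, e) (a', c', x', y', t', e') =>
    if a = a' ∧ c = c' ∧ x = x' ∧ y = y' ∧ t = t' then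
      (S.prob x y t : ℂ) * D.block σ a c x y t e e'
    else 0

/-- The partial state `𝓜(σ)_{A X Y T E ∧ c}`. -/
def Device.outAnd (D : Device S dA dB) (σ : Matrix (Sys dA dB dE) (Sys dA dB dE) ℂ) (c : C) :
    Matrix (A × (X × Y × Bool × Fin dE)) (A × (X × Y × Bool × Fin dE)) ℂ :=
  fun (a, r) (a', r') => D.out σ (a, c, r) (a', c, r')

/-- The marginal `𝓜(σ)_{X Y T E}`. -/
def Device.outXYTE (D : Device S dA dB) (σ : Matrix (Sys dA dB dE) (Sys dA dB dE) ℂ) :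
    Matrix (X × Y × Bool × Fin dE) (X × Y × Bool × Fin dE) ℂ :=
  fun r r' => ∑ a, ∑ c, D.out σ (a, c, r) (a, c, r')

/-- `p(c) = Tr[ 𝓜(σ)_{AXYTE ∧ c}^α · (1_A ⊗ 𝓜(σ)_{XYTE})^(1-α) ]` (a real number). -/
def Device.petz (D : Device S dA dB) (σ : Matrix (Sys dA dB dE) (Sys dA dB dE) ℂ) (α : ℝ)
    (c : C) : ℝ :=
  (Matrix.trace (mpow (D.outAnd σ c) α *
    ((1 : Matrix A A ℂ) ⊗ₖ mpow (D.outXYTE σ) (1 - α)))).re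

/-- The device-independent single-round quantity: the infimum of `1/(α-1) · D(q ‖ p)` over all
finite-dimensional systems `Q_A, Q_B, E`, all POVM families, all `q ∈ SΩ`, and all normalized
states `σ` on `Q_A Q_B E`. -/
def singleRoundValue (S : Protocol X Y A B C) (SΩ : Set (C → ℝ)) (α : ℝ) : EReal :=
  ⨅ (dA : ℕ) (dB : ℕ) (dE : ℕ) (D : Device S dA dB) (q ∈ SΩ)
    (σ : Matrix (Sys dA dB dE) (Sys dA dB dE) ℂ) (_ : IsState σ),
    ((1 / (α - 1) : ℝ) : EReal) * relEnt q (D.petz σ α)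

end

/-! ### Noncommutative polynomials -/

/-- The noncommuting variables: the operators `M_{a|x}`, `N_{b|y}`, `Z_{c,a,i}^{x,y,t}` and
`Z_{c,a,i}^{x,y,t †}`. -/
inductive Letter (X Y A B C : Type*) (m : ℕ)
  | M (x : X) (a : A)
  | N (y : Y) (b : B)
  | Z (c : C) (a : A) (x : X) (y : Y) (t : Bool) (i : Fin m)
  | Zdag (c : C) (a : A) (x : X) (y : Y) (t : Bool) (i : Fin m)

/-- The formal adjoint of a letter. -/
def Letter.adj {X Y A B C : Type*} {m : ℕ} : Letter X Y A B C m → Letter X Y A B C m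
  | .M x a => .M x a
  | .N y b => .N y b
  | .Z c a x y t i => .Zdag c a x y t i
  | .Zdag c a x y t i => .Z c a x y t i

/-- Words in the noncommuting variables. -/
abbrev Word (X Y A B C : Type*) (m : ℕ) := FreeMonoid (Letter X Y A B C m)

/-- The formal adjoint of a word: reverse it and take the adjoint of every letter. -/
def wstar {X Y A B C : Type*} {m : ℕ} (v : Word X Y A B C m) : Word X Y A B C m :=
  FreeMonoid.ofList (v.toList.map Letter.adj).reverse

/-- Noncommutative polynomials. All polynomials of the problem have real coefficients. -/
abbrev NCPoly (X Y A B C : Type*) (m : ℕ) := MonoidAlgebra ℝ (Word X Y A B C m)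

/-- A variable, as a polynomial. -/
def var {X Y A B C : Type*} {m : ℕ} (l : Letter X Y A B C m) : NCPoly X Y A B C m :=
  MonoidAlgebra.of ℝ (Word X Y A B C m) (FreeMonoid.of l)

section

variable {X Y A B C : Type*} {m : ℕ}

/-- `P(Z_{c,a,1}^{x,y,t}, …) = 1 + sin(απ)/π ∑ᵢ (wᵢ/tᵢ) (1 + Zᵢ + Zᵢ† + (1 - tᵢ) Zᵢ† Zᵢ)`. -/
def polyP (α : ℝ) (nd w : Fin m → ℝ) (c : C) (a : A) (x : X) (y : Y) (t : Bool) :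
    NCPoly X Y A B C m :=
  1 + (Real.sin (α * Real.pi) / Real.pi) • ∑ i, (w i / nd i) •
    (1 + var (.Z c a x y t i) + var (.Zdag c a x y t i)
      + (1 - nd i) • (var (.Zdag c a x y t i) * var (.Z c a x y t i)))

/-- `Q(Z_{c,a,1}^{x,y,t}, …) = sin(απ)/π ∑ᵢ wᵢ Zᵢ Zᵢ†`. -/
def polyQ (α : ℝ) (w : Fin m → ℝ) (c : C) (a : A) (x : X) (y : Y) (t : Bool) :
    NCPoly X Y A B C m :=
  (Real.sin (α * Real.pi) / Real.pi) • ∑ i, w i •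
    (var (.Z c a x y t i) * var (.Zdag c a x y t i))

end

section

variable {X Y A B C : Type*} [Fintype X] [Fintype Y] [DecidableEq C]

/-- The polynomial that bounds `p(c)`: the sum over `x, y, t` and over those `a ∈ A_x` that can
generate `c`, of
`P(x,y,t) ( ∑_{b ∈ B_y : test(a,b,x,y,t) = c} M_{a|x} N_{b|y} P(Z) + Q(Z) )`. -/
def objective (S : Protocol X Y A B C) (α : ℝ) {m : ℕ} (nd w : Fin m → ℝ) (c : C) :
    NCPoly X Y A B C m :=
  ∑ x, ∑ y, ∑ t, S.prob x y t •
    ∑ a ∈ S.outA x with ∃ b ∈ S.outB y, S.test a b x y t = c,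
      ((∑ b ∈ S.outB y with S.test a b x y t = c,
          var (.M x a) * var (.N y b) * polyP α nd w c a x y t)
        + polyQ α w c a x y t)

/-- The polynomials that the problem constrains to be zero: completeness of the POVMs, absence of
outcomes outside of the output sets, and the commutation relations
`[M, N] = [M, Z] = [M, Z†] = [N, Z] = [N, Z†] = 0`. -/
inductive EqConstraint (S : Protocol X Y A B C) (m : ℕ) : NCPoly X Y A B C m → Prop
  | sumM (x : X) : EqConstraint S m (∑ a ∈ S.outA x, var (.M x a) - 1)
  | sumN (y : Y) : EqConstraint S m (∑ b ∈ S.outB y, var (.N y b) - 1)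
  | outM (x : X) (a : A) (h : a ∉ S.outA x) : EqConstraint S m (var (.M x a))
  | outN (y : Y) (b : B) (h : b ∉ S.outB y) : EqConstraint S m (var (.N y b))
  | commMN (x : X) (a : A) (y : Y) (b : B) :
      EqConstraint S m (var (.M x a) * var (.N y b) - var (.N y b) * var (.M x a))
  | commMZ (x' : X) (a' : A) (c : C) (a : A) (x : X) (y : Y) (t : Bool) (i : Fin m) :
      EqConstraint S m
        (var (.M x' a') * var (.Z c a x y t i) - var (.Z c a x y t i) * var (.M x' a'))
  | commMZdag (x' : X) (a' : A) (c : C) (a : A) (x : X) (y : Y) (t : Bool) (i : Fin m) :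
      EqConstraint S m
        (var (.M x' a') * var (.Zdag c a x y t i) - var (.Zdag c a x y t i) * var (.M x' a'))
  | commNZ (y' : Y) (b' : B) (c : C) (a : A) (x : X) (y : Y) (t : Bool) (i : Fin m) :
      EqConstraint S m
        (var (.N y' b') * var (.Z c a x y t i) - var (.Z c a x y t i) * var (.N y' b'))
  | commNZdag (y' : Y) (b' : B) (c : C) (a : A) (x : X) (y : Y) (t : Bool) (i : Fin m) :
      EqConstraint S m
        (var (.N y' b') * var (.Zdag c a x y t i) - var (.Zdag c a x y t i) * var (.N y' b'))

/-! ### NPA relaxations -/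

/-- The operators that the problem constrains to be positive semidefinite, `M_{a|x}` and
`N_{b|y}`. -/
def posLetter (m : ℕ) : (X × A) ⊕ (Y × B) → Letter X Y A B C m
  | .inl (x, a) => .M x a
  | .inr (y, b) => .N y b

/-- An NPA relaxation of the problem. It is specified by the finite set `mono` of monomials that
have a moment variable, the finite set `basis` of monomials that index the moment matrix, for each
of the constraints `M_{a|x} ⪰ 0`, `N_{b|y} ⪰ 0` the finite set `loc` of monomials that index the
localizing matrix, and a finite set `eqs` of linear equations between moments, each of them the
expansion of an element of the two-sided ideal of the equality constraints. Every moment that is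
used, also by the objective polynomials, has to have a variable. (The relaxation of order `k` has
as `basis` the words of length at most `k`, and as `mono` those of length at most `2k`; the local
bases may be empty and `eqs` may use any part of the ideal, so that sets of monomials other than
the full levels and the elimination of monomials modulo the equality constraints are included.) -/
structure NPARelaxation (S : Protocol X Y A B C) (α : ℝ) {m : ℕ} (nd w : Fin m → ℝ) where
  mono : Finset (Word X Y A B C m)
  basis : Finset (Word X Y A B C m)
  loc : (X × A) ⊕ (Y × B) → Finset (Word X Y A B C m)
  eqs : Finset (NCPoly X Y A B C m)
  one_mem : 1 ∈ basis
  basis_mem : ∀ u ∈ basis, ∀ v ∈ basis, wstar u * v ∈ mono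
  loc_mem : ∀ g, ∀ u ∈ loc g, ∀ v ∈ loc g, wstar u * FreeMonoid.of (posLetter m g) * v ∈ mono
  eqs_mono : ∀ r ∈ eqs, r.coeff.support ⊆ mono
  eqs_ideal : ∀ r ∈ eqs, r ∈ TwoSidedIdeal.span {s | EqConstraint S m s}
  objective_mono : ∀ c, (objective S α nd w c).coeff.support ⊆ mono

namespace NPARelaxation

variable {S : Protocol X Y A B C} {α : ℝ} {m : ℕ} {nd w : Fin m → ℝ}

/-- The index set of the variables `y_1, …, y_N`: one for each monomial. -/
abbrev Idx (R : NPARelaxation S α nd w) : Type _ := {v // v ∈ R.mono}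

/-- The index of the variable of the empty word, which is called `y_1`. -/
def one (R : NPARelaxation S α nd w) : R.Idx :=
  ⟨1, by simpa [wstar] using R.basis_mem 1 R.one_mem 1 R.one_mem⟩

/-- The substitution of the variables `y` for the monomials of a polynomial. -/
def riesz (R : NPARelaxation S α nd w) (y : R.Idx → ℝ) (p : NCPoly X Y A B C m) : ℝ :=
  ∑ v : R.Idx, p.coeff v.1 * y v

variable [DecidableEq X] [DecidableEq Y] [DecidableEq A] [DecidableEq B]

/-- The rows of `M(y)`: those of the moment matrix, of the localizing matrices, and two `1 × 1`
blocks for every equation. -/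
abbrev Row (R : NPARelaxation S α nd w) : Type _ :=
  {v // v ∈ R.basis} ⊕ ((Σ g, {v // v ∈ R.loc g}) ⊕ ({r // r ∈ R.eqs} ⊕ {r // r ∈ R.eqs}))

open Classical in
/-- The matrix `M(y)` of the relaxation, block diagonal with the moment matrix `y(u† v)`, the
localizing matrices `y(u† M_{a|x} v)` and `y(u† N_{b|y} v)`, and for every equation `r = 0` the
`1 × 1` blocks `y(r)` and `-y(r)`. -/
def momentMatrix (R : NPARelaxation S α nd w) (y : R.Idx → ℝ) : Matrix R.Row R.Row ℝ :=
  Matrix.fromBlocks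
    (Matrix.of fun u v => y ⟨wstar u.1 * v.1, R.basis_mem u.1 u.2 v.1 v.2⟩) 0 0
    (Matrix.fromBlocks
      (Matrix.blockDiagonal' fun g => Matrix.of fun u v =>
        y ⟨wstar u.1 * FreeMonoid.of (posLetter m g) * v.1, R.loc_mem g u.1 u.2 v.1 v.2⟩) 0 0
      (Matrix.fromBlocks
        (Matrix.diagonal fun r => R.riesz y r.1) 0 0
        (Matrix.diagonal fun r => - R.riesz y r.1)))

end NPARelaxation

end

/-! ### The convex program -/

/-- The epigraph of the program `min 1/(α-1) · D(q ‖ f(y))` subject to `q ∈ SΩ` and `F y`. -/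
def programEpigraph {C I : Type*} [Fintype C] (SΩ : Set (C → ℝ)) (α : ℝ)
    (F : (I → ℝ) → Prop) (f : C → (I → ℝ) → ℝ) : Set ((C → ℝ) × (I → ℝ) × ℝ) :=
  {z | z.1 ∈ SΩ ∧ F z.2.1 ∧
    ((1 / (α - 1) : ℝ) : EReal) * relEnt z.1 (fun c => f c z.2.1) ≤ (z.2.2 : EReal)}

/-- The value of the program `inf 1/(α-1) · D(q ‖ f(y))` subject to `q ∈ SΩ` and `F y`. -/
def programValue {C I : Type*} [Fintype C] (SΩ : Set (C → ℝ)) (α : ℝ)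
    (F : (I → ℝ) → Prop) (f : C → (I → ℝ) → ℝ) : EReal :=
  ⨅ (q ∈ SΩ) (y : I → ℝ) (_ : F y),
    ((1 / (α - 1) : ℝ) : EReal) * relEnt q (fun c => f c y)

end DIRenyi

end

/-! A moment argument turns a quantum strategy into a feasible point of the relaxation, once the
trace `Tr[ρ ^ α σ ^ (1 - α)]` is bounded above by the expectation of a polynomial in the measurement
operators and auxiliary operators `Z`. For numbers `p, q > 0`, the difference
`p ^ α q ^ (1 - α) - p` is a positive multiple of the integral of `p (x - 1) / (s + x (1 - s))`,
`x = p / q`, against the Jacobi weight. The Gauss–Radau rule over-estimates this integral, since the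
interpolation error at the node `1` and the double interior nodes has the sign of
`(s - 1) P(s) ^ 2`; and at each node the integrand is the maximum over `z` of a concave quadratic.
Diagonalizing `ρ` and `σ` separately reduces the trace to pairs of eigenvalues, whose maximizers
assemble into the matrices `Z`.

The bound `p(c) ≤ f_c(y)` passes to the programs since `D(q‖·)` is antitone, and the relaxation is
convex by the log-sum inequality. -/

noncomputable section

namespace DIRenyi

section GaussRadau

open Polynomial

/-- A linear functional on real polynomials that is strictly positive on the nonzero polynomials
that are nonnegative on `[a, b]`: the abstract form of integration against a weight. -/
def IsPositiveOn (a b : ℝ) (L : ℝ[X] →ₗ[ℝ] ℝ) : Prop :=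
  ∀ p : ℝ[X], p ≠ 0 → (∀ s ∈ Set.Icc a b, 0 ≤ p.eval s) → 0 < L p

/-- `p` is orthogonal, for the bilinear form `(p, q) ↦ L (p q)`, to all polynomials of smaller
degree. -/
def IsOrthogonalPolynomial {K : Type*} [Field K] (L : K[X] →ₗ[K] K) (p : K[X]) : Prop :=
  ∀ q : K[X], q.degree < p.degree → L (p * q) = 0

theorem exists_monic_isOrthogonalPolynomial {K : Type*} [Field K] {L : K[X] →ₗ[K] K}
    (hL : ∀ p : K[X], p ≠ 0 → L (p * p) ≠ 0) (n : ℕ) :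
    ∃ p : K[X], p.Monic ∧ p.natDegree = n ∧ IsOrthogonalPolynomial L p := by
  let form : degreeLT K n →ₗ[K] Module.Dual K (degreeLT K n) :=
    ((LinearMap.mul K K[X]).compr₂ L).domRestrict₁₂ _ _
  have form_apply : ∀ p q, form p q = L (p.1 * q.1) := fun _ _ => rfl
  have form_injective : Function.Injective form := by
    refine (injective_iff_map_eq_zero form).2 fun p hp => ?_
    by_contra hne
    exact hL p.1 (by simpa using hne) (by rw [← form_apply, hp, LinearMap.zero_apply])
  have form_surjective : Function.Surjective form :=
    (LinearMap.injective_iff_surjective_of_finrank_eq_finrank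
      (Subspace.dual_finrank_eq (K := K) (V := degreeLT K n)).symm).1 form_injective
  obtain ⟨r, hr⟩ := form_surjective ((L ∘ₗ LinearMap.mulLeft K (X ^ n)).domRestrict _)
  have hmonic : (X ^ n - r.1).Monic := monic_X_pow_sub (mem_degreeLT.1 r.2)
  have hdegree : (X ^ n - r.1).degree = (n : WithBot ℕ) := by
    rw [degree_sub_eq_left_of_degree_lt (by simpa using mem_degreeLT.1 r.2), degree_X_pow]
  refine ⟨X ^ n - r.1, hmonic, natDegree_eq_of_degree_eq_some hdegree, ?_⟩
  intro q hq
  have hrq : L (r.1 * q) = L (X ^ n * q) := by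
    rw [hdegree] at hq
    simpa only [form_apply, LinearMap.domRestrict_apply, LinearMap.comp_apply,
      LinearMap.mulLeft_apply] using DFunLike.congr_fun hr ⟨q, mem_degreeLT.2 hq⟩
  rw [sub_mul, map_sub, hrq, sub_self]

variable {a b : ℝ} {L : ℝ[X] →ₗ[ℝ] ℝ}

theorem IsPositiveOn.mul_self_pos (hL : IsPositiveOn a b L) {p : ℝ[X]} (hp : p ≠ 0) :
    0 < L (p * p) :=
  hL _ (mul_ne_zero hp hp) fun s _ => by simpa only [eval_mul] using mul_self_nonneg (p.eval s)

theorem IsPositiveOn.comp_mulLeft_C_sub_X (hL : IsPositiveOn a b L) :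
    IsPositiveOn a b (L ∘ₗ LinearMap.mulLeft ℝ (C b - X)) := by
  have hne : (C b - X : ℝ[X]) ≠ 0 := by
    rw [← neg_ne_zero, neg_sub]
    exact X_sub_C_ne_zero b
  refine fun p hp h => hL _ (mul_ne_zero hne hp) fun s hs => ?_
  simpa using mul_nonneg (sub_nonneg.2 hs.2) (h s hs)

theorem eval_nonneg_or_nonpos_of_roots_eq_zero {g : ℝ[X]} (hroots : g.roots = 0) :
    (∀ s, 0 ≤ g.eval s) ∨ ∀ s, g.eval s ≤ 0 := by
  rcases eq_or_ne g 0 with rfl | hg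
  · simp
  by_contra! ⟨⟨u, hu⟩, v, hv⟩
  obtain ⟨s, hs⟩ : (0 : ℝ) ∈ Set.range fun s => g.eval s :=
    mem_range_of_exists_le_of_exists_ge g.continuous ⟨u, hu.le⟩ ⟨v, hv.le⟩
  have hmem : s ∈ g.roots := (mem_roots hg).2 hs
  simp [hroots] at hmem

/-- Otherwise the cofactor `h` would have smaller degree, but `L (p h) = L (d h²) ≠ 0`. -/
theorem IsPositiveOn.natDegree_eq_zero_of_dvd (hL : IsPositiveOn a b L) {p d : ℝ[X]} (hp : p ≠ 0)
    (horth : IsOrthogonalPolynomial L p) (hdvd : d ∣ p)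
    (hsign : (∀ s ∈ Set.Icc a b, 0 ≤ d.eval s) ∨ ∀ s ∈ Set.Icc a b, d.eval s ≤ 0) :
    d.natDegree = 0 := by
  wlog hd : ∀ s ∈ Set.Icc a b, 0 ≤ d.eval s generalizing d
  · rw [← natDegree_neg]
    have hneg : ∀ s ∈ Set.Icc a b, 0 ≤ (-d).eval s := by
      simpa using hsign.resolve_left hd
    exact this ((neg_dvd).2 hdvd) (Or.inl hneg) hneg
  obtain ⟨h, rfl⟩ := hdvd
  obtain ⟨hd0, hh0⟩ := mul_ne_zero_iff.1 hp
  by_contra hdeg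
  have hlt : h.degree < (d * h).degree := by
    refine degree_lt_degree ?_
    rw [natDegree_mul hd0 hh0]
    omega
  have hpos : 0 < L (d * h * h) := hL _ (mul_ne_zero hp hh0) fun s hs => by
    rw [eval_mul, eval_mul, mul_assoc]
    exact mul_nonneg (hd s hs) (mul_self_nonneg _)
  exact hpos.ne' (horth h hlt)

theorem IsPositiveOn.splits (hL : IsPositiveOn a b L) {p : ℝ[X]} (hp : p ≠ 0)
    (horth : IsOrthogonalPolynomial L p) : p.Splits := by
  obtain ⟨g, hg, hcard, hroots⟩ := exists_prod_multiset_X_sub_C_mul p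
  have hdeg : g.natDegree = 0 := by
    refine hL.natDegree_eq_zero_of_dvd hp horth (Dvd.intro_left _ hg) ?_
    exact (eval_nonneg_or_nonpos_of_roots_eq_zero hroots).imp (fun h s _ => h s) fun h s _ => h s
  rw [splits_iff_card_roots, ← hcard, hdeg, add_zero]

theorem IsPositiveOn.roots_nodup (hL : IsPositiveOn a b L) {p : ℝ[X]} (hp : p ≠ 0)
    (horth : IsOrthogonalPolynomial L p) : p.roots.Nodup := by
  refine Multiset.nodup_iff_count_le_one.2 fun z => ?_
  rw [count_roots]
  by_contra! hmult
  have hdeg := hL.natDegree_eq_zero_of_dvd hp horth ((le_rootMultiplicity_iff hp).1 hmult)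
    (Or.inl fun s _ => by simpa using sq_nonneg (s - z))
  simp at hdeg

theorem IsPositiveOn.mem_Ioo_of_mem_roots (hL : IsPositiveOn a b L) {p : ℝ[X]} (hp : p ≠ 0)
    (horth : IsOrthogonalPolynomial L p) {z : ℝ} (hz : z ∈ p.roots) : z ∈ Set.Ioo a b := by
  by_contra hout
  have hsign : (∀ s ∈ Set.Icc a b, 0 ≤ (X - C z).eval s) ∨
      ∀ s ∈ Set.Icc a b, (X - C z).eval s ≤ 0 := by
    simp only [eval_sub, eval_X, eval_C, sub_nonneg, sub_nonpos]
    rw [Set.mem_Ioo, not_and_or, not_lt, not_lt] at hout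
    exact hout.imp (fun h s hs => h.trans hs.1) fun h s hs => hs.2.trans h
  have hdeg := hL.natDegree_eq_zero_of_dvd hp horth (dvd_iff_isRoot.2 ((mem_roots hp).1 hz)) hsign
  simp at hdeg

theorem IsPositiveOn.weight_pos (hL : IsPositiveOn a b L) {ι : Type*} {T : Finset ι} {v : ι → ℝ}
    (hv : Set.InjOn v T) {w : ι → ℝ} (hexact : ∀ p : ℝ[X], p.natDegree ≤ 2 * (T.card - 1) →
      L p = ∑ i ∈ T, w i * p.eval (v i)) {i : ι} (hi : i ∈ T) : 0 < w i := by
  classical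
  have hdeg : (Lagrange.basis T v i * Lagrange.basis T v i).natDegree ≤ 2 * (T.card - 1) := by
    rw [← sq, natDegree_pow, Lagrange.natDegree_basis hv hi]
  have hpos := hL.mul_self_pos (Lagrange.basis_ne_zero hv hi)
  rw [hexact _ hdeg, Finset.sum_eq_single_of_mem i hi] at hpos
  · simpa [Lagrange.eval_basis_self hv hi] using hpos
  · intro j hj hji
    simp [Lagrange.eval_basis_of_ne hji.symm hj]

variable {ι K : Type*} [DecidableEq ι] [Field K] {T : Finset ι} {v : ι → K}

theorem linearMap_eq_sum_basis (L : K[X] →ₗ[K] K) (hv : Set.InjOn v T) {p : K[X]}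
    (hp : p.degree < T.card) : L p = ∑ i ∈ T, L (Lagrange.basis T v i) * p.eval (v i) := by
  conv_lhs => rw [Lagrange.eq_interpolate hv hp, Lagrange.interpolate_apply, map_sum]
  refine Finset.sum_congr rfl fun i _ => ?_
  rw [← smul_eq_C_mul, map_smul, smul_eq_mul, mul_comm]

theorem linearMap_eq_sum_basis_of_nodal_orthogonal {L : K[X] →ₗ[K] K} (hv : Set.InjOn v T) {k : ℕ}
    (horth : ∀ q : K[X], q.degree < k → L (Lagrange.nodal T v * q) = 0) {p : K[X]}
    (hp : p.degree < (T.card + k : ℕ)) :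
    L p = ∑ i ∈ T, L (Lagrange.basis T v i) * p.eval (v i) := by
  have hmonic : (Lagrange.nodal T v).Monic := Lagrange.nodal_monic
  have hrem : (p %ₘ Lagrange.nodal T v).degree < T.card := by
    simpa only [Lagrange.degree_nodal] using degree_modByMonic_lt p hmonic
  have hquot : (p /ₘ Lagrange.nodal T v).degree < k := by
    by_cases hle : (Lagrange.nodal T v).degree ≤ p.degree
    · have hsum := degree_add_divByMonic hmonic hle
      rw [← hsum, Lagrange.degree_nodal, Nat.cast_add] at hp
      exact lt_of_add_lt_add_left hp
    · rw [(divByMonic_eq_zero_iff hmonic).2 (not_le.1 hle), degree_zero]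
      exact WithBot.bot_lt_coe k
  calc L p = L (p %ₘ Lagrange.nodal T v) := by
        conv_lhs => rw [← modByMonic_add_div p (Lagrange.nodal T v), map_add, horth _ hquot,
          add_zero]
    _ = ∑ i ∈ T, L (Lagrange.basis T v i) * (p %ₘ Lagrange.nodal T v).eval (v i) :=
        linearMap_eq_sum_basis L hv hrem
    _ = ∑ i ∈ T, L (Lagrange.basis T v i) * p.eval (v i) := by
        refine Finset.sum_congr rfl fun i hi => ?_
        rw [← coe_aeval_eq_eval, aeval_modByMonic_eq_self_of_root]
        exact Lagrange.eval_nodal_at_node hi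

theorem IsPositiveOn.exists_nodal_orthogonal (hL : IsPositiveOn a b L) (hab : a < b) (n : ℕ) :
    ∃ T : Finset ℝ, T.card = n + 1 ∧ b ∈ T ∧ (∀ z ∈ T, z ∈ Set.Ioc a b) ∧
      ∀ q : ℝ[X], q.degree < n → L (Lagrange.nodal T id * q) = 0 := by
  have hL' := hL.comp_mulLeft_C_sub_X
  obtain ⟨P, hmonic, hdeg, horth⟩ :=
    exists_monic_isOrthogonalPolynomial (fun p hp => (hL'.mul_self_pos hp).ne') n
  have hsplits := hL'.splits hmonic.ne_zero horth
  have hnodup := hL'.roots_nodup hmonic.ne_zero horth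
  have hIoo : ∀ z ∈ P.roots.toFinset, z ∈ Set.Ioo a b := fun z hz =>
    hL'.mem_Ioo_of_mem_roots hmonic.ne_zero horth (Multiset.mem_toFinset.1 hz)
  have hb : b ∉ P.roots.toFinset := fun h => (hIoo b h).2.ne rfl
  have hP : Lagrange.nodal P.roots.toFinset id = P := by
    conv_rhs => rw [hsplits.eq_prod_roots_of_monic hmonic]
    rw [Lagrange.nodal_eq, Finset.prod_multiset_map_count]
    refine Finset.prod_congr rfl fun z hz => ?_
    rw [Multiset.count_eq_one_of_mem hnodup (Multiset.mem_toFinset.1 hz), pow_one, id]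
  refine ⟨insert b P.roots.toFinset, ?_, Finset.mem_insert_self _ _, ?_, fun q hq => ?_⟩
  · rw [Finset.card_insert_of_notMem hb, Multiset.toFinset_card_of_nodup hnodup,
      splits_iff_card_roots.1 hsplits, hdeg]
  · exact Finset.forall_mem_insert .. |>.2 ⟨Set.right_mem_Ioc.2 hab,
      fun z hz => Set.Ioo_subset_Ioc_self (hIoo z hz)⟩
  · have hPq : L ((C b - X) * (P * q)) = 0 := horth q (by
      rwa [degree_eq_natDegree hmonic.ne_zero, hdeg])
    rw [Lagrange.nodal_insert_eq_nodal hb, hP, id, ← neg_eq_zero, ← map_neg, ← hPq]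
    congr 1
    ring

theorem IsPositiveOn.exists_gaussRadau (hL : IsPositiveOn a b L) (hab : a < b) {m : ℕ}
    (hm : 1 ≤ m) :
    ∃ t w : Fin m → ℝ, StrictMono t ∧ (∀ i, t i ∈ Set.Ioc a b) ∧ (∃ i, t i = b) ∧
      (∀ i, 0 < w i) ∧ ∀ p : ℝ[X], p.natDegree ≤ 2 * m - 2 → L p = ∑ i, w i * p.eval (t i) := by
  obtain ⟨n, rfl⟩ := Nat.exists_eq_add_of_le' hm
  obtain ⟨T, hcard, hbT, hIoc, horth⟩ := hL.exists_nodal_orthogonal hab n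
  let t := T.orderEmbOfFin hcard
  have hrange : Set.range t = T := T.range_orderEmbOfFin hcard
  have hinj : Set.InjOn t (Finset.univ : Finset (Fin (n + 1))) := t.injective.injOn
  have hnodal : Lagrange.nodal Finset.univ t = Lagrange.nodal T id := by
    have himage : Finset.univ.image t = T := by
      rw [← Finset.coe_inj, Finset.coe_image, Finset.coe_univ, Set.image_univ, hrange]
    rw [← himage, Lagrange.nodal_eq, Lagrange.nodal_eq, Finset.prod_image hinj]
    rfl
  have hexact : ∀ p : ℝ[X], p.natDegree ≤ 2 * (n + 1) - 2 →
      L p = ∑ i, L (Lagrange.basis Finset.univ t i) * p.eval (t i) := fun p hp => by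
    refine linearMap_eq_sum_basis_of_nodal_orthogonal hinj (hnodal ▸ horth) ?_
    refine degree_le_natDegree.trans_lt (Nat.cast_lt.2 ?_)
    rw [Finset.card_univ, Fintype.card_fin]
    omega
  refine ⟨t, fun i => L (Lagrange.basis Finset.univ t i), t.strictMono,
    fun i => hIoc _ (T.orderEmbOfFin_mem hcard i), ?_, fun i => ?_, hexact⟩
  · rwa [← Finset.mem_coe, ← hrange] at hbT
  · refine hL.weight_pos hinj (w := fun i => L (Lagrange.basis Finset.univ t i))
      (fun p hp => hexact p ?_) (Finset.mem_univ i)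
    simpa [mul_add] using hp

end GaussRadau

section Jacobi

open MeasureTheory Set

theorem ofReal_beta_integrand (u v : ℝ) {s : ℝ} (hs : s ∈ Ioo (0 : ℝ) 1) :
    (s : ℂ) ^ ((u : ℂ) - 1) * (1 - (s : ℂ)) ^ ((v : ℂ) - 1)
      = ((s ^ (u - 1) * (1 - s) ^ (v - 1) : ℝ) : ℂ) := by
  rw [Complex.ofReal_mul, Complex.ofReal_cpow hs.1.le, Complex.ofReal_cpow (sub_nonneg.2 hs.2.le)]
  push_cast
  rfl

theorem integrableOn_beta {u v : ℝ} (hu : 0 < u) (hv : 0 < v) :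
    IntegrableOn (fun s : ℝ => s ^ (u - 1) * (1 - s) ^ (v - 1)) (Ioo 0 1) := by
  have h := Complex.betaIntegral_convergent (u := u) (v := v) (by simpa) (by simpa)
  rw [intervalIntegrable_iff_integrableOn_Ioo_of_le zero_le_one] at h
  exact (h.congr_fun (fun s hs => ofReal_beta_integrand u v hs) measurableSet_Ioo).re

theorem setIntegral_beta {u v : ℝ} (hu : 0 < u) (hv : 0 < v) :
    ∫ s in Ioo (0 : ℝ) 1, s ^ (u - 1) * (1 - s) ^ (v - 1) = ProbabilityTheory.beta u v := by
  rw [ProbabilityTheory.beta_eq_betaIntegralReal u v hu hv, Complex.betaIntegral,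
    intervalIntegral.integral_of_le zero_le_one, integral_Ioc_eq_integral_Ioo,
    setIntegral_congr_fun measurableSet_Ioo (fun s hs => ofReal_beta_integrand u v hs),
    integral_complex_ofReal, Complex.ofReal_re]

theorem setIntegral_beta_one_sub {r : ℝ} (hr : r ∈ Ioo (0 : ℝ) 1) :
    ∫ s in Ioo (0 : ℝ) 1, s ^ (r - 1) * (1 - s) ^ (-r) = Real.pi / Real.sin (Real.pi * r) := by
  have h := setIntegral_beta hr.1 (sub_pos.2 hr.2)
  rw [ProbabilityTheory.beta, Real.Gamma_mul_Gamma_one_sub] at h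
  simpa using h

theorem add_mul_one_sub_pos {x s : ℝ} (hx : 0 < x) (hs : s ∈ Icc (0 : ℝ) 1) :
    0 < s + x * (1 - s) := by
  rcases hs.1.eq_or_lt with rfl | hs0
  · simpa using hx
  · exact add_pos_of_pos_of_nonneg hs0 (mul_nonneg hx.le (sub_nonneg.2 hs.2))

/-- The fractional linear map that fixes `0` and `1` and has derivative `1 / x` at `0`; it is the
substitution that turns `∫ s^(r-1) (1-s)^(-r) x / (s + x (1-s)) ds` into a beta integral. -/
def mobius (x s : ℝ) : ℝ := s / (s + x * (1 - s))

section Mobius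

variable {x s : ℝ}

theorem one_sub_mobius (hx : 0 < x) (hs : s ∈ Ioo (0 : ℝ) 1) :
    1 - mobius x s = x * (1 - s) / (s + x * (1 - s)) := by
  have hu := add_mul_one_sub_pos hx (Ioo_subset_Icc_self hs)
  rw [mobius, one_sub_div hu.ne', add_sub_cancel_left]

theorem mobius_mem_Ioo (hx : 0 < x) (hs : s ∈ Ioo (0 : ℝ) 1) : mobius x s ∈ Ioo (0 : ℝ) 1 := by
  have hu := add_mul_one_sub_pos hx (Ioo_subset_Icc_self hs)
  refine ⟨div_pos hs.1 hu, sub_pos.1 ?_⟩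
  rw [one_sub_mobius hx hs]
  exact div_pos (mul_pos hx (sub_pos.2 hs.2)) hu

theorem mobius_inv_mobius (hx : 0 < x) (hs : s ∈ Ioo (0 : ℝ) 1) :
    mobius x⁻¹ (mobius x s) = s := by
  have hu := add_mul_one_sub_pos hx (Ioo_subset_Icc_self hs)
  have hden : mobius x s + x⁻¹ * (1 - mobius x s) = 1 / (s + x * (1 - s)) := by
    rw [one_sub_mobius hx hs, mobius]
    field_simp
    ring
  rw [mobius, hden, mobius, div_div_div_cancel_right₀ hu.ne', div_one]

theorem bijOn_mobius (hx : 0 < x) : BijOn (mobius x) (Ioo 0 1) (Ioo 0 1) := by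
  have hinv : InvOn (mobius x⁻¹) (mobius x) (Ioo 0 1) (Ioo 0 1) :=
    ⟨fun s hs => mobius_inv_mobius hx hs, fun s hs => by
      simpa only [inv_inv] using mobius_inv_mobius (inv_pos.2 hx) hs⟩
  exact hinv.bijOn (fun s hs => mobius_mem_Ioo hx hs) fun s hs => mobius_mem_Ioo (inv_pos.2 hx) hs

theorem hasDerivAt_mobius (hx : 0 < x) (hs : s ∈ Ioo (0 : ℝ) 1) :
    HasDerivAt (mobius x) (x / (s + x * (1 - s)) ^ 2) s := by
  have hu := add_mul_one_sub_pos hx (Ioo_subset_Icc_self hs)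
  have hden : HasDerivAt (fun s : ℝ => s + x * (1 - s)) (1 + x * (-1)) s :=
    (hasDerivAt_id s).add (((hasDerivAt_id s).const_sub 1).const_mul x)
  refine ((hasDerivAt_id s).div hden hu.ne').congr_deriv ?_
  rw [id]
  congr 1
  ring

theorem deriv_mul_beta_integrand_mobius (r : ℝ) (hx : 0 < x) (hs : s ∈ Ioo (0 : ℝ) 1) :
    x ^ r * (x / (s + x * (1 - s)) ^ 2 * (mobius x s ^ (r - 1) * (1 - mobius x s) ^ (-r)))
      = s ^ (r - 1) * (1 - s) ^ (-r) * (x / (s + x * (1 - s))) := by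
  have hu := add_mul_one_sub_pos hx (Ioo_subset_Icc_self hs)
  have hs1 : 0 < 1 - s := sub_pos.2 hs.2
  rw [one_sub_mobius hx hs, mobius]
  set u := s + x * (1 - s)
  rw [Real.div_rpow hs.1.le hu.le, Real.div_rpow (mul_pos hx hs1).le hu.le,
    Real.mul_rpow hx.le hs1.le, Real.rpow_neg hx.le, Real.rpow_neg hu.le, Real.rpow_sub_one hu.ne']
  have hxr := (Real.rpow_pos_of_pos hx r).ne'
  have hur := (Real.rpow_pos_of_pos hu r).ne'
  field_simp [hxr, hur]

theorem setIntegral_beta_mobius {r : ℝ} (hr : r ∈ Ioo (0 : ℝ) 1) (hx : 0 < x) :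
    ∫ s in Ioo (0 : ℝ) 1, s ^ (r - 1) * (1 - s) ^ (-r) * (x / (s + x * (1 - s)))
      = x ^ r * (Real.pi / Real.sin (Real.pi * r)) := by
  have hsubst := integral_image_eq_integral_abs_deriv_smul measurableSet_Ioo
    (fun s hs => (hasDerivAt_mobius hx hs).hasDerivWithinAt) (bijOn_mobius hx).injOn
    fun τ => τ ^ (r - 1) * (1 - τ) ^ (-r)
  rw [(bijOn_mobius hx).image_eq, setIntegral_beta_one_sub hr] at hsubst
  rw [hsubst, ← integral_const_mul]
  refine setIntegral_congr_fun measurableSet_Ioo fun s hs => ?_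
  simp only [smul_eq_mul]
  rw [abs_of_nonneg (div_nonneg hx.le (sq_nonneg _)), deriv_mul_beta_integrand_mobius r hx hs]

end Mobius

/-- The Jacobi weight of `IsGaussRadauJacobi`. -/
def jacobi (α s : ℝ) : ℝ := s ^ (α - 1) * (1 - s) ^ (1 - α)

variable {α : ℝ}

theorem jacobi_pos {s : ℝ} (hs : s ∈ Ioo (0 : ℝ) 1) : 0 < jacobi α s :=
  mul_pos (Real.rpow_pos_of_pos hs.1 _) (Real.rpow_pos_of_pos (sub_pos.2 hs.2) _)

theorem integrableOn_continuousOn_mul {f g : ℝ → ℝ} (hf : ContinuousOn f (Icc 0 1))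
    (hg : IntegrableOn g (Ioo 0 1)) : IntegrableOn (fun s => f s * g s) (Ioo 0 1) := by
  rw [← integrableOn_Icc_iff_integrableOn_Ioo] at hg ⊢
  exact hg.continuousOn_mul hf isCompact_Icc

theorem integrableOn_mul_jacobi (hα : α ∈ Ioo (1 : ℝ) 2) {f : ℝ → ℝ}
    (hf : ContinuousOn f (Icc 0 1)) : IntegrableOn (fun s => f s * jacobi α s) (Ioo 0 1) := by
  refine integrableOn_continuousOn_mul hf ?_
  have h := integrableOn_beta (u := α) (v := 2 - α) (by linarith [hα.1]) (by linarith [hα.2])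
  rwa [show 2 - α - 1 = 1 - α by ring] at h

/-- The function whose integrals against `jacobi α` represent `x ^ (α - 1)`. -/
def resolventKernel (x s : ℝ) : ℝ := (x - 1) / (s + x * (1 - s))

theorem continuousOn_resolventKernel {x : ℝ} (hx : 0 < x) :
    ContinuousOn (resolventKernel x) (Icc 0 1) :=
  continuousOn_const.div (by fun_prop) fun _ hs => (add_mul_one_sub_pos hx hs).ne'

theorem setIntegral_resolventKernel_mul_jacobi (hα : α ∈ Ioo (1 : ℝ) 2) {x : ℝ} (hx : 0 < x) :
    ∫ s in Ioo (0 : ℝ) 1, resolventKernel x s * jacobi α s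
      = (x ^ (α - 1) - 1) * (Real.pi / Real.sin (Real.pi * (α - 1))) := by
  have hr : α - 1 ∈ Ioo (0 : ℝ) 1 := ⟨by linarith [hα.1], by linarith [hα.2]⟩
  have hbeta : IntegrableOn (fun s : ℝ => s ^ (α - 1 - 1) * (1 - s) ^ (-(α - 1))) (Ioo 0 1) := by
    have h := integrableOn_beta hr.1 (sub_pos.2 hr.2)
    rwa [show 1 - (α - 1) - 1 = -(α - 1) by ring] at h
  have hcont : ContinuousOn (fun s : ℝ => x / (s + x * (1 - s))) (Icc 0 1) :=
    continuousOn_const.div (by fun_prop) fun s hs => (add_mul_one_sub_pos hx hs).ne'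
  have hbeta' : IntegrableOn (fun s : ℝ => s ^ (α - 1 - 1) * (1 - s) ^ (-(α - 1))
      * (x / (s + x * (1 - s)))) (Ioo 0 1) := by
    simpa only [mul_comm] using integrableOn_continuousOn_mul hcont hbeta
  rw [sub_mul, one_mul, ← setIntegral_beta_mobius hr hx, ← setIntegral_beta_one_sub hr,
    ← integral_sub hbeta' hbeta]
  refine setIntegral_congr_fun measurableSet_Ioo fun s hs => ?_
  have hu := add_mul_one_sub_pos hx (Ioo_subset_Icc_self hs)
  simp only [resolventKernel, jacobi, ← neg_sub α 1]
  rw [Real.rpow_sub_one hs.1.ne' (α - 1)]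
  have hs0 := hs.1.ne'
  field_simp
  ring

/-- Integration of polynomials against the Jacobi weight. -/
def jacobiFunctional (hα : α ∈ Ioo (1 : ℝ) 2) : Polynomial ℝ →ₗ[ℝ] ℝ where
  toFun p := ∫ s in Ioo (0 : ℝ) 1, p.eval s * jacobi α s
  map_add' p q := by
    rw [← integral_add (integrableOn_mul_jacobi hα p.continuous.continuousOn)
      (integrableOn_mul_jacobi hα q.continuous.continuousOn)]
    simp [add_mul]
  map_smul' c p := by
    rw [RingHom.id_apply, smul_eq_mul, ← integral_const_mul]
    simp [mul_assoc]

theorem isPositiveOn_jacobiFunctional (hα : α ∈ Ioo (1 : ℝ) 2) :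
    IsPositiveOn 0 1 (jacobiFunctional hα) := by
  intro p hp h
  change 0 < ∫ s in Ioo (0 : ℝ) 1, p.eval s * jacobi α s
  have hnonneg : ∀ s ∈ Ioo (0 : ℝ) 1, 0 ≤ p.eval s * jacobi α s := fun s hs =>
    mul_nonneg (h s (Ioo_subset_Icc_self hs)) (jacobi_pos hs).le
  rw [setIntegral_pos_iff_support_of_nonneg_ae (ae_restrict_of_forall_mem measurableSet_Ioo hnonneg)
    (integrableOn_mul_jacobi hα p.continuous.continuousOn)]
  have hsub : Ioo (0 : ℝ) 1 \ (p.roots.toFinset : Set ℝ) ⊆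
      (Function.support fun s => p.eval s * jacobi α s) ∩ Ioo 0 1 := by
    rintro s ⟨hs, hroot⟩
    refine ⟨mul_ne_zero (fun h0 => hroot ?_) (jacobi_pos hs).ne', hs⟩
    simpa [hp] using h0
  refine lt_of_lt_of_le ?_ (measure_mono hsub)
  rw [measure_sdiff_null (Finset.measure_zero _ _)]
  simp

theorem exists_isGaussRadauJacobi (hα : α ∈ Ioo (1 : ℝ) 2) {m : ℕ} (hm : 1 ≤ m) :
    ∃ t w : Fin m → ℝ, IsGaussRadauJacobi α m t w := by
  obtain ⟨t, w, hmono, hmem, hend, hpos, hexact⟩ :=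
    (isPositiveOn_jacobiFunctional hα).exists_gaussRadau zero_lt_one hm
  refine ⟨t, w, hmono, hmem, hend, hpos, fun p hp => ?_⟩
  rw [← hexact p hp, intervalIntegral.integral_of_le zero_le_one, integral_Ioc_eq_integral_Ioo]
  rfl

end Jacobi

section Majorant

open Polynomial MeasureTheory

/-- The interpolation of `(x - 1) / (s + x (1 - s))` at the double zeros of `P` and the simple node
`1`, together with its error term; the pole of the function is at `x / (x - 1)`. -/
theorem exists_interpolation_resolventKernel {K : Type*} [Field K] {x : K} (hx : x ≠ 1) {P : K[X]}
    (hP : P.eval (x / (x - 1)) ≠ 0) :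
    ∃ H : K[X], H.natDegree ≤ 2 * P.natDegree ∧ ∀ s, H.eval s * (s + x * (1 - s))
      = x - 1 + ((x - 1) / P.eval (x / (x - 1))) ^ 2 * ((1 - s) * P.eval s ^ 2) := by
  have hx' : x - 1 ≠ 0 := sub_ne_zero.2 hx
  set pole := x / (x - 1) with hpole
  set e := P.eval pole
  let G : K[X] := C (x - 1) + C ((x - 1) / e) ^ 2 * ((1 - X) * P ^ 2)
  have hG : ∀ s, G.eval s = x - 1 + ((x - 1) / e) ^ 2 * ((1 - s) * P.eval s ^ 2) := fun s => by
    simp [G]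
  have hroot : G.IsRoot pole := by
    rw [IsRoot.def, hG, div_pow, hpole]
    change x - 1 + (x - 1) ^ 2 / e ^ 2 * ((1 - x / (x - 1)) * e ^ 2) = 0
    field_simp
    ring
  have hGdeg : G.natDegree ≤ 2 * P.natDegree + 1 := by
    simp only [G]
    compute_degree
    omega
  refine ⟨C (-(x - 1)⁻¹) * (G /ₘ (X - C pole)), ?_, fun s => ?_⟩
  · refine (natDegree_C_mul_le _ _).trans ?_
    rw [natDegree_divByMonic _ (monic_X_sub_C _), natDegree_X_sub_C]
    omega
  · have hfactor : (s - pole) * (G /ₘ (X - C pole)).eval s = G.eval s := by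
      conv_rhs => rw [← mul_divByMonic_eq_iff_isRoot.2 hroot]
      simp
    rw [← hG, ← hfactor, eval_mul, eval_C, hpole]
    field_simp
    ring

theorem exists_majorant_resolventKernel {x : ℝ} (hx : 0 < x) {T : Finset ℝ}
    (hT : ∀ z ∈ T, z ∈ Set.Icc (0 : ℝ) 1) :
    ∃ H : ℝ[X], H.natDegree ≤ 2 * T.card ∧
      (∀ s ∈ Set.Icc (0 : ℝ) 1, resolventKernel x s ≤ H.eval s) ∧
      ∀ s ∈ Set.Icc (0 : ℝ) 1, s = 1 ∨ s ∈ T → H.eval s = resolventKernel x s := by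
  rcases eq_or_ne x 1 with rfl | hx1
  · exact ⟨0, by simp [resolventKernel]⟩
  have hx' : x - 1 ≠ 0 := sub_ne_zero.2 hx1
  have hpole : x / (x - 1) ∉ Set.Icc (0 : ℝ) 1 := fun hmem => by
    have hpos := add_mul_one_sub_pos hx hmem
    have hzero : x / (x - 1) + x * (1 - x / (x - 1)) = 0 := by
      field_simp
      ring
    exact hpos.ne' hzero
  have hP : (Lagrange.nodal T id).eval (x / (x - 1)) ≠ 0 :=
    Lagrange.eval_nodal_not_at_node fun z hz h => hpole (h ▸ hT z hz)
  obtain ⟨H, hdeg, hH⟩ := exists_interpolation_resolventKernel hx1 hP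
  refine ⟨H, by rwa [Lagrange.natDegree_nodal] at hdeg, fun s hs => ?_, fun s hs hnode => ?_⟩
  · rw [resolventKernel, div_le_iff₀ (add_mul_one_sub_pos hx hs), hH]
    have := sub_nonneg.2 hs.2
    exact le_add_of_nonneg_right (by positivity)
  · rw [resolventKernel, eq_div_iff (add_mul_one_sub_pos hx hs).ne', hH]
    rcases hnode with rfl | hs
    · simp
    · have hroot : (Lagrange.nodal T id).eval s = 0 := Lagrange.eval_nodal_at_node (v := id) hs
      simp [hroot]

theorem IsGaussRadauJacobi.le_sum_resolventKernel {α : ℝ} (hα : α ∈ Set.Ioo (1 : ℝ) 2) {m : ℕ}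
    {t w : Fin m → ℝ} (h : IsGaussRadauJacobi α m t w) {x : ℝ} (hx : 0 < x) :
    (x ^ (α - 1) - 1) * (Real.pi / Real.sin (Real.pi * (α - 1)))
      ≤ ∑ i, w i * resolventKernel x (t i) := by
  obtain ⟨i₁, hi₁⟩ := h.endpoint
  have hmem : ∀ i, t i ∈ Set.Icc (0 : ℝ) 1 := fun i => Set.Ioc_subset_Icc_self (h.node_mem i)
  obtain ⟨H, hdeg, hle, heq⟩ := exists_majorant_resolventKernel hx
    (T := (Finset.univ.erase i₁).image t) (by simpa using fun i _ => hmem i)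
  have hdeg' : H.natDegree ≤ 2 * m - 2 := by
    have hcard : ((Finset.univ.erase i₁).image t).card ≤ m - 1 :=
      Finset.card_image_le.trans (by simp)
    omega
  have hnodes : ∀ i, H.eval (t i) = resolventKernel x (t i) := fun i => by
    refine heq _ (hmem i) ?_
    rcases eq_or_ne i i₁ with rfl | hi
    · exact Or.inl hi₁
    · exact Or.inr (Finset.mem_image_of_mem t (Finset.mem_erase.2 ⟨hi, Finset.mem_univ i⟩))
  calc (x ^ (α - 1) - 1) * (Real.pi / Real.sin (Real.pi * (α - 1)))
      = ∫ s in Set.Ioo (0 : ℝ) 1, resolventKernel x s * jacobi α s :=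
        (setIntegral_resolventKernel_mul_jacobi hα hx).symm
    _ ≤ ∫ s in Set.Ioo (0 : ℝ) 1, H.eval s * jacobi α s :=
        setIntegral_mono_on (integrableOn_mul_jacobi hα (continuousOn_resolventKernel hx))
          (integrableOn_mul_jacobi hα H.continuous.continuousOn) measurableSet_Ioo fun s hs =>
          mul_le_mul_of_nonneg_right (hle s (Set.Ioo_subset_Icc_self hs)) (jacobi_pos hs).le
    _ = ∑ i, w i * H.eval (t i) := by
        rw [← h.exact H hdeg', intervalIntegral.integral_of_le zero_le_one,
          integral_Ioc_eq_integral_Ioo]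
        rfl
    _ = ∑ i, w i * resolventKernel x (t i) := by simp only [hnodes]

end Majorant

section VariationalBound

/-- The coefficient `sin(απ)/π` of the quadrature sums in `polyP` and `polyQ`; it is negative for
`α ∈ (1, 2)`. -/
def sinCoeff (α : ℝ) : ℝ := Real.sin (α * Real.pi) / Real.pi

theorem sin_pi_mul_sub_one (α : ℝ) :
    Real.sin (Real.pi * (α - 1)) = -Real.sin (α * Real.pi) := by
  rw [mul_comm, sub_mul, one_mul, Real.sin_sub_pi]

theorem sinCoeff_neg {α : ℝ} (hα : α ∈ Set.Ioo (1 : ℝ) 2) : sinCoeff α < 0 := by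
  refine div_neg_of_neg_of_pos ?_ Real.pi_pos
  rw [← neg_pos, ← sin_pi_mul_sub_one]
  exact Real.sin_pos_of_pos_of_lt_pi (mul_pos Real.pi_pos (by linarith [hα.1]))
    (by nlinarith [hα.2, Real.pi_pos])

theorem sinCoeff_mul_pi_div_sin {α : ℝ} (hα : α ∈ Set.Ioo (1 : ℝ) 2) :
    sinCoeff α * (Real.pi / Real.sin (Real.pi * (α - 1))) = -1 := by
  have hsin : Real.sin (α * Real.pi) ≠ 0 := (div_ne_zero_iff.1 (sinCoeff_neg hα).ne).1
  have hpi := Real.pi_ne_zero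
  rw [sin_pi_mul_sub_one, sinCoeff]
  field_simp

variable {m : ℕ} {α : ℝ} {t w : Fin m → ℝ}

/-- The value of `p · P(z) + q · Q(z)`, with `P` and `Q` as in `polyP` and `polyQ`, at commuting
real arguments `z`. -/
def scalarBound (α : ℝ) (t w : Fin m → ℝ) (p q : ℝ) (z : Fin m → ℝ) : ℝ :=
  p + sinCoeff α * ∑ i, w i / t i * (p * (1 + 2 * z i + (1 - t i) * z i ^ 2))
    + sinCoeff α * ∑ i, w i * (q * z i ^ 2)

theorem scalarBound_single {p : ℝ} {i₁ : Fin m} (ht : t i₁ = 1) (c : ℝ) :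
    scalarBound α t w p 0 (Pi.single i₁ c)
      = scalarBound α t w p 0 0 + 2 * sinCoeff α * w i₁ * p * c := by
  have hterm : ∀ i, w i / t i * (p * (1 + 2 * (Pi.single i₁ c : Fin m → ℝ) i
      + (1 - t i) * (Pi.single i₁ c : Fin m → ℝ) i ^ 2))
      = w i / t i * p + (Pi.single i₁ (2 * w i₁ * p * c) : Fin m → ℝ) i := by
    intro i
    rcases eq_or_ne i i₁ with rfl | hi
    · simp only [Pi.single_eq_same, ht]
      ring
    · simp [Pi.single_eq_of_ne hi]
  simp only [scalarBound, hterm, Finset.sum_add_distrib, Finset.sum_pi_single', Finset.mem_univ,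
    if_true]
  simp
  ring

theorem exists_scalarBound_eq_zero (hα : α ∈ Set.Ioo (1 : ℝ) 2) (h : IsGaussRadauJacobi α m t w)
    {p : ℝ} (hp : 0 < p) : ∃ z, scalarBound α t w p 0 z = 0 := by
  obtain ⟨i₁, hi₁⟩ := h.endpoint
  have hκ := (sinCoeff_neg hα).ne
  have hw := (h.weight_pos i₁).ne'
  refine ⟨Pi.single i₁ (-scalarBound α t w p 0 0 / (2 * sinCoeff α * w i₁ * p)), ?_⟩
  rw [scalarBound_single hi₁]
  field_simp
  ring

/-- The quadratic polynomial in each `z i` is stationary at this argument. -/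
theorem scalarBound_stationary (h : IsGaussRadauJacobi α m t w) {p q : ℝ} (hp : 0 < p)
    (hq : 0 < q) :
    scalarBound α t w p q (fun i => -p / (p * (1 - t i) + t i * q))
      = p - sinCoeff α * p * ∑ i, w i * resolventKernel (p / q) (t i) := by
  have hterm : ∀ i, w i / t i * (p * (1 + 2 * (-p / (p * (1 - t i) + t i * q))
        + (1 - t i) * (-p / (p * (1 - t i) + t i * q)) ^ 2))
      + w i * (q * (-p / (p * (1 - t i) + t i * q)) ^ 2)
      = -p * (w i * resolventKernel (p / q) (t i)) := fun i => by
    have hden : 0 < p * (1 - t i) + t i * q :=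
      add_pos_of_nonneg_of_pos (mul_nonneg hp.le (sub_nonneg.2 (h.node_mem i).2))
        (mul_pos (h.node_mem i).1 hq)
    have ht := (h.node_mem i).1.ne'
    have hkernel : t i + p / q * (1 - t i) = (p * (1 - t i) + t i * q) / q := by
      field_simp
      ring
    rw [resolventKernel, hkernel]
    field_simp
    ring
  rw [scalarBound, add_assoc, ← mul_add, ← Finset.sum_add_distrib,
    Finset.sum_congr rfl fun i _ => hterm i, ← Finset.mul_sum]
  ring

theorem le_scalarBound_stationary (hα : α ∈ Set.Ioo (1 : ℝ) 2) (h : IsGaussRadauJacobi α m t w)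
    {p q : ℝ} (hp : 0 < p) (hq : 0 < q) :
    p ^ α * q ^ (1 - α) ≤ scalarBound α t w p q fun i => -p / (p * (1 - t i) + t i * q) := by
  have hpow : p ^ α * q ^ (1 - α) = p * (p / q) ^ (α - 1) := by
    rw [Real.div_rpow hp.le hq.le, ← neg_sub α 1, Real.rpow_neg hq.le, Real.rpow_sub_one hp.ne']
    field_simp
  have hκp : 0 ≤ -sinCoeff α * p := mul_nonneg (neg_pos.2 (sinCoeff_neg hα)).le hp.le
  have hquad := mul_le_mul_of_nonneg_left (h.le_sum_resolventKernel hα (div_pos hp hq)) hκp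
  rw [scalarBound_stationary h hp hq, hpow]
  linear_combination hquad + p * ((p / q) ^ (α - 1) - 1) * sinCoeff_mul_pi_div_sin hα

theorem exists_le_scalarBound (hα : α ∈ Set.Ioo (1 : ℝ) 2) (h : IsGaussRadauJacobi α m t w)
    {p q : ℝ} (hp : 0 ≤ p) (hq : 0 ≤ q) :
    ∃ z, p ^ α * q ^ (1 - α) ≤ scalarBound α t w p q z := by
  rcases hp.eq_or_lt with rfl | hp
  · exact ⟨0, by simp [scalarBound, Real.zero_rpow (by linarith [hα.1] : α ≠ 0)]⟩
  rcases hq.eq_or_lt with rfl | hq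
  · obtain ⟨z, hz⟩ := exists_scalarBound_eq_zero hα h hp
    exact ⟨z, by rw [hz, Real.zero_rpow (by linarith [hα.1]), mul_zero]⟩
  · exact ⟨_, le_scalarBound_stationary hα h hp hq⟩

open Matrix

variable {n : Type*} [Fintype n] [DecidableEq n]

/-- The operator `∑ a(j,i) |v_j⟩⟨v_j| |u_i⟩⟨u_i|` for the orthonormal bases `u`, `v` formed by the
columns of `U` and `V`; it acts as a scalar would if the two bases could be diagonalized
simultaneously. -/
def schurMultiplier (U V : unitaryGroup n ℂ) (a : Matrix n n ℝ) : Matrix n n ℂ :=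
  (V : Matrix n n ℂ) * (a.map Complex.ofReal ⊙ ((V : Matrix n n ℂ)ᴴ * U)) * (U : Matrix n n ℂ)ᴴ

/-- The matrix `U diag(p) U†` with eigenvalues `p` and eigenbasis the columns of `U`. -/
def unitaryConj (U : unitaryGroup n ℂ) (p : n → ℝ) : Matrix n n ℂ :=
  (U : Matrix n n ℂ) * diagonal (fun i => (p i : ℂ)) * (U : Matrix n n ℂ)ᴴ

variable (U V : unitaryGroup n ℂ)

theorem unitaryConj_one : unitaryConj U 1 = 1 := by
  have hU : (U : Matrix n n ℂ) * (U : Matrix n n ℂ)ᴴ = 1 := Unitary.coe_mul_star_self U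
  simp [unitaryConj, hU]

theorem schurMultiplier_one : schurMultiplier U V (of fun _ _ => 1) = 1 := by
  have hhad : (of fun _ _ => (1 : ℝ) : Matrix n n ℝ).map Complex.ofReal
      ⊙ ((V : Matrix n n ℂ)ᴴ * U) = (V : Matrix n n ℂ)ᴴ * U := by
    ext i j
    simp
  have hU : (U : Matrix n n ℂ) * (U : Matrix n n ℂ)ᴴ = 1 := Unitary.coe_mul_star_self U
  have hV : (V : Matrix n n ℂ) * (V : Matrix n n ℂ)ᴴ = 1 := Unitary.coe_mul_star_self V
  rw [schurMultiplier, hhad, ← mul_assoc, hV, one_mul, hU]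

theorem trace_schurMultiplier (a b : Matrix n n ℝ) (p q : n → ℝ) :
    ((schurMultiplier U V a)ᴴ * unitaryConj V q * schurMultiplier U V b
        * unitaryConj U p).trace.re
      = ∑ x : n × n, p x.1 * q x.2 * (a x.2 x.1 * b x.2 x.1)
          * Complex.normSq (((V : Matrix n n ℂ)ᴴ * U) x.2 x.1) := by
  have hU : (U : Matrix n n ℂ)ᴴ * U = 1 := Unitary.coe_star_mul_self U
  have hV : (V : Matrix n n ℂ)ᴴ * V = 1 := Unitary.coe_star_mul_self V
  simp only [schurMultiplier, unitaryConj]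
  set K := (V : Matrix n n ℂ)ᴴ * U
  have hcancel : ((V : Matrix n n ℂ) * (a.map Complex.ofReal ⊙ K) * (U : Matrix n n ℂ)ᴴ)ᴴ
        * ((V : Matrix n n ℂ) * diagonal (fun j => (q j : ℂ)) * (V : Matrix n n ℂ)ᴴ)
        * ((V : Matrix n n ℂ) * (b.map Complex.ofReal ⊙ K) * (U : Matrix n n ℂ)ᴴ)
        * ((U : Matrix n n ℂ) * diagonal (fun i => (p i : ℂ)) * (U : Matrix n n ℂ)ᴴ)
      = (U : Matrix n n ℂ) * ((a.map Complex.ofReal ⊙ K)ᴴ * diagonal (fun j => (q j : ℂ))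
          * (b.map Complex.ofReal ⊙ K)
          * diagonal (fun i => (p i : ℂ))) * (U : Matrix n n ℂ)ᴴ := by
    simp only [conjTranspose_mul, conjTranspose_conjTranspose, mul_assoc]
    simp only [← mul_assoc _ (V : Matrix n n ℂ), ← mul_assoc _ (U : Matrix n n ℂ), hU, hV, one_mul]
  rw [hcancel, trace_mul_comm, ← mul_assoc, hU, one_mul, trace, Complex.re_sum,
    Fintype.sum_prod_type]
  refine Finset.sum_congr rfl fun i _ => ?_
  rw [diag_apply, mul_diagonal, mul_apply, Finset.sum_mul, Complex.re_sum]
  refine Finset.sum_congr rfl fun j _ => ?_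
  rw [mul_diagonal, conjTranspose_apply, hadamard_apply, hadamard_apply, map_apply, map_apply,
    ← Complex.ofReal_re (p i * q j * (a j i * b j i) * Complex.normSq (K j i))]
  congr 1
  push_cast [Complex.normSq_eq_conj_mul_self]
  simp only [star_mul', RCLike.star_def, Complex.conj_ofReal]
  ring

/-- The real part of `Tr[P(Z) ρ] + Tr[Q(Z) τ]`, with `P` and `Q` as in `polyP` and `polyQ`. -/
def matrixBound (α : ℝ) (t w : Fin m → ℝ) (ρ τ : Matrix n n ℂ) (Z : Fin m → Matrix n n ℂ) : ℝ :=
  ρ.trace.re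
    + sinCoeff α * ∑ i, w i / t i *
      ((1 + Z i + (Z i)ᴴ + ((1 - t i : ℝ) : ℂ) • ((Z i)ᴴ * Z i)) * ρ).trace.re
    + sinCoeff α * ∑ i, w i * (Z i * (Z i)ᴴ * τ).trace.re

theorem matrixBound_schurMultiplier (p q : n → ℝ) (z : n × n → Fin m → ℝ) :
    matrixBound α t w (unitaryConj U p) (unitaryConj V q)
        (fun k => schurMultiplier U V (of fun j i => z (i, j) k))
      = ∑ x : n × n, scalarBound α t w (p x.1) (q x.2) (z x)
          * Complex.normSq (((V : Matrix n n ℂ)ᴴ * U) x.2 x.1) := by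
  have hquad := trace_schurMultiplier U V
  have htrace := hquad (of fun _ _ => 1) (of fun _ _ => 1) p 1
  have hZ := fun k => hquad (of fun _ _ => 1) (of fun j i => z (i, j) k) p 1
  have hZstar := fun k => hquad (of fun j i => z (i, j) k) (of fun _ _ => 1) p 1
  have hZstarZ := fun k => hquad (of fun j i => z (i, j) k) (of fun j i => z (i, j) k) p 1
  have hZZstar := fun k => hquad (of fun j i => z (i, j) k) (of fun j i => z (i, j) k) 1 q
  simp only [schurMultiplier_one, unitaryConj_one, conjTranspose_one, one_mul, mul_one, of_apply,
    Pi.one_apply] at htrace hZ hZstar hZstarZ hZZstar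
  have hcycle : ∀ k, (schurMultiplier U V (of fun j i => z (i, j) k)
      * (schurMultiplier U V (of fun j i => z (i, j) k))ᴴ * unitaryConj V q).trace
      = ((schurMultiplier U V (of fun j i => z (i, j) k))ᴴ * unitaryConj V q
        * schurMultiplier U V (of fun j i => z (i, j) k)).trace := fun k => by
    rw [mul_assoc, trace_mul_comm]
  simp only [matrixBound, scalarBound, add_mul, one_mul, Matrix.smul_mul, trace_add, trace_smul,
    smul_eq_mul, Complex.add_re, Complex.re_ofReal_mul, hcycle, htrace, hZ, hZstar, hZstarZ,
    hZZstar, Finset.mul_sum, Finset.sum_mul, ← Finset.sum_add_distrib]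
  rw [Finset.sum_comm, Finset.sum_comm (s := (Finset.univ : Finset (Fin m))),
    ← Finset.sum_add_distrib, ← Finset.sum_add_distrib]
  refine Finset.sum_congr rfl fun x _ => ?_
  congr 1
  · congr 1
    refine Finset.sum_congr rfl fun k _ => ?_
    ring
  · refine Finset.sum_congr rfl fun k _ => ?_
    ring

theorem trace_unitaryConj_mul_unitaryConj (p q : n → ℝ) :
    (unitaryConj U p * unitaryConj V q).trace.re
      = ∑ x : n × n, p x.1 * q x.2 * Complex.normSq (((V : Matrix n n ℂ)ᴴ * U) x.2 x.1) := by
  have h := trace_schurMultiplier U V (of fun _ _ => 1) (of fun _ _ => 1) p q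
  simp only [schurMultiplier_one, conjTranspose_one, one_mul, mul_one, of_apply] at h
  rw [trace_mul_comm, h]

theorem eq_unitaryConj {ρ : Matrix n n ℂ} (hρ : ρ.IsHermitian) :
    ρ = unitaryConj hρ.eigenvectorUnitary hρ.eigenvalues :=
  hρ.spectral_theorem

theorem mpow_eq_unitaryConj {ρ : Matrix n n ℂ} (hρ : ρ.IsHermitian) (r : ℝ) :
    mpow ρ r = unitaryConj hρ.eigenvectorUnitary fun i => hρ.eigenvalues i ^ r := by
  rw [mpow, hρ.cfc_eq]
  rfl

theorem exists_le_matrixBound (hα : α ∈ Set.Ioo (1 : ℝ) 2) (h : IsGaussRadauJacobi α m t w)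
    {ρ τ : Matrix n n ℂ} (hρ : ρ.PosSemidef) (hτ : τ.PosSemidef) :
    ∃ Z, (mpow ρ α * mpow τ (1 - α)).trace.re ≤ matrixBound α t w ρ τ Z := by
  choose z hz using fun x : n × n =>
    exists_le_scalarBound hα h (hρ.eigenvalues_nonneg x.1) (hτ.eigenvalues_nonneg x.2)
  refine ⟨fun k => schurMultiplier hρ.1.eigenvectorUnitary hτ.1.eigenvectorUnitary
    (of fun j i => z (i, j) k), ?_⟩
  have hbound := matrixBound_schurMultiplier (α := α) (t := t) (w := w) hρ.1.eigenvectorUnitary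
    hτ.1.eigenvectorUnitary hρ.1.eigenvalues hτ.1.eigenvalues z
  rw [← eq_unitaryConj hρ.1, ← eq_unitaryConj hτ.1] at hbound
  rw [mpow_eq_unitaryConj hρ.1, mpow_eq_unitaryConj hτ.1, trace_unitaryConj_mul_unitaryConj,
    hbound]
  exact Finset.sum_le_sum fun x _ =>
    mul_le_mul_of_nonneg_right (hz x) (Complex.normSq_nonneg _)

end VariationalBound

open Matrix

section Intertwine

variable {n k : Type*} [Fintype n] [DecidableEq n] [Fintype k] [DecidableEq k]

theorem aeval_mul_eq_mul_aeval {R : Type*} [CommSemiring R] {A : Matrix n n R} {B : Matrix k k R}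
    {V : Matrix n k R} {K : Type*} [CommSemiring K] [Algebra K R] (h : A * V = V * B)
    (p : Polynomial K) : Polynomial.aeval A p * V = V * Polynomial.aeval B p := by
  induction p using Polynomial.induction_on' with
  | add p q hp hq => simp only [map_add, Matrix.add_mul, Matrix.mul_add, hp, hq]
  | monomial d a =>
    have hpow : A ^ d * V = V * B ^ d := by
      induction d with
      | zero => simp
      | succ d ih => rw [pow_succ', pow_succ', Matrix.mul_assoc, ih, ← Matrix.mul_assoc, h,
          Matrix.mul_assoc]
    rw [Polynomial.aeval_monomial, Polynomial.aeval_monomial, ← Algebra.smul_def,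
      ← Algebra.smul_def, Matrix.smul_mul, Matrix.mul_smul, hpow]

theorem cfc_mul_eq_mul_cfc {𝕜 : Type*} [RCLike 𝕜] {A : Matrix n n 𝕜} {B : Matrix k k 𝕜}
    {V : Matrix n k 𝕜} (hA : A.IsHermitian) (hB : B.IsHermitian) (h : A * V = V * B)
    (f : ℝ → ℝ) : cfc f A * V = V * cfc f B := by
  have hfin := A.finite_real_spectrum.union B.finite_real_spectrum
  let p := Lagrange.interpolate hfin.toFinset id f
  have hp : (spectrum ℝ A ∪ spectrum ℝ B).EqOn f p.eval := fun s hs =>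
    (Lagrange.eval_interpolate_at_node f Function.injective_id.injOn (hfin.mem_toFinset.2 hs)).symm
  rw [cfc_congr (hp.mono Set.subset_union_left), cfc_congr (hp.mono Set.subset_union_right),
    cfc_polynomial p A hA.isSelfAdjoint, cfc_polynomial p B hB.isSelfAdjoint,
    aeval_mul_eq_mul_aeval h]

end Intertwine

section CoordEmb

variable {R : Type*} [Semiring R] {n k : Type*} [DecidableEq n]

/-- The isometry that embeds the coordinates `k` into the coordinates `n` along `φ`. The equation
`A * coordEmb R φ = coordEmb R φ * B` says that `A` is block diagonal with block `B` on the range of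
an injective `φ`. -/
def coordEmb (R : Type*) [Zero R] [One R] (φ : k → n) : Matrix n k R :=
  (1 : Matrix n n R).submatrix id φ

theorem mul_coordEmb_apply [Fintype n] (A : Matrix n n R) (φ : k → n) (x : n) (j : k) :
    (A * coordEmb R φ) x j = A x (φ j) := by
  simp [coordEmb, mul_apply, one_apply]

theorem coordEmb_mul_apply [Fintype k] (φ : k → n) (B : Matrix k k R) (x : n) (j : k) :
    (coordEmb R φ * B) x j = ∑ i, if x = φ i then B i j else 0 := by
  simp [coordEmb, mul_apply, one_apply]

theorem apply_of_mul_coordEmb [Fintype n] [Fintype k] {φ : k → n} (hφ : φ.Injective)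
    {A : Matrix n n R} {B : Matrix k k R} (h : A * coordEmb R φ = coordEmb R φ * B) (i j : k) :
    A (φ i) (φ j) = B i j := by
  rw [← mul_coordEmb_apply A φ, h, coordEmb_mul_apply, Finset.sum_eq_single i, if_pos rfl]
  · exact fun i' _ hi => if_neg (hφ.ne hi.symm)
  · simp

theorem one_kronecker_mul_coordEmb [Fintype n] [Fintype k] {l : Type*} [Fintype l] [DecidableEq l]
    {φ : k → n} {A : Matrix n n R} {B : Matrix k k R}
    (h : A * coordEmb R φ = coordEmb R φ * B) (a : l) :
    ((1 : Matrix l l R) ⊗ₖ A) * coordEmb R (fun j => (a, φ j))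
      = coordEmb R (fun j => (a, φ j)) * B := by
  ext ⟨a', x⟩ j
  have hx := congrFun (congrFun h x) j
  rw [mul_coordEmb_apply, coordEmb_mul_apply] at hx
  rw [mul_coordEmb_apply, coordEmb_mul_apply, kroneckerMap_apply, hx, one_apply]
  by_cases ha : a' = a <;> simp [ha]

end CoordEmb

section PartialTrace

variable {m n : Type*} [Fintype m]

theorem trFst_zero : trFst (0 : Matrix (m × n) (m × n) ℂ) = 0 := by
  ext
  simp [trFst]

theorem trFst_sum {ι : Type*} (s : Finset ι) (ρ : ι → Matrix (m × n) (m × n) ℂ) :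
    trFst (∑ i ∈ s, ρ i) = ∑ i ∈ s, trFst (ρ i) := by
  ext e e'
  simp only [trFst, Matrix.sum_apply]
  rw [Finset.sum_comm]

theorem posSemidef_trFst {ρ : Matrix (m × n) (m × n) ℂ} (h : ρ.PosSemidef) :
    (trFst ρ).PosSemidef := by
  have hsum : trFst ρ = ∑ k, ρ.submatrix (fun e => (k, e)) (fun e => (k, e)) := by
    ext e e'
    simp [trFst, Matrix.sum_apply]
  rw [hsum]
  exact posSemidef_sum _ fun k _ => h.submatrix _

variable [Fintype n]

theorem trace_mul_trFst [DecidableEq m] (W : Matrix n n ℂ) (ρ : Matrix (m × n) (m × n) ℂ) :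
    (W * trFst ρ).trace = (((1 : Matrix m m ℂ) ⊗ₖ W) * ρ).trace := by
  simp only [trace, diag_apply, mul_apply, trFst, kroneckerMap_apply, Fintype.sum_prod_type,
    one_apply, ite_mul, one_mul, zero_mul, Finset.mul_sum, Finset.sum_ite_irrel,
    Finset.sum_const_zero, Finset.sum_ite_eq, Finset.mem_univ, if_true]
  simp_rw [Finset.sum_comm (s := (Finset.univ : Finset n)) (t := (Finset.univ : Finset m))]

variable [DecidableEq n]

theorem trFst_kronecker_one_mul_comm (G : Matrix m m ℂ) (ρ : Matrix (m × n) (m × n) ℂ) :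
    trFst ((G ⊗ₖ (1 : Matrix n n ℂ)) * ρ) = trFst (ρ * (G ⊗ₖ (1 : Matrix n n ℂ))) := by
  ext e e'
  simp only [trFst, mul_apply, kroneckerMap_apply, Fintype.sum_prod_type, one_apply, mul_ite,
    mul_one, mul_zero, ite_mul, zero_mul, Finset.sum_ite_eq, Finset.sum_ite_eq', Finset.mem_univ,
    if_true]
  rw [Finset.sum_comm]
  exact Finset.sum_congr rfl fun _ _ => Finset.sum_congr rfl fun _ _ => mul_comm _ _

open scoped MatrixOrder Matrix.Norms.L2Operator in
theorem posSemidef_trFst_kronecker_mul {G : Matrix m m ℂ}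
    {ρ : Matrix (m × n) (m × n) ℂ} (hG : G.PosSemidef) (h : ρ.PosSemidef) :
    (trFst ((G ⊗ₖ (1 : Matrix n n ℂ)) * ρ)).PosSemidef := by
  classical
  obtain ⟨K, rfl⟩ := CStarAlgebra.nonneg_iff_eq_star_mul_self.1 hG.nonneg
  have hfactor : (star K * K) ⊗ₖ (1 : Matrix n n ℂ) = (Kᴴ ⊗ₖ 1) * (K ⊗ₖ 1) := by
    rw [← mul_kronecker_mul, one_mul, star_eq_conjTranspose]
  have hconj := h.mul_mul_conjTranspose_same (K ⊗ₖ (1 : Matrix n n ℂ))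
  rw [conjTranspose_kronecker, conjTranspose_one] at hconj
  rw [hfactor, mul_assoc, trFst_kronecker_one_mul_comm]
  exact posSemidef_trFst hconj

theorem trace_mul_trFst_kronecker (G : Matrix m m ℂ) (W : Matrix n n ℂ)
    (ρ : Matrix (m × n) (m × n) ℂ) :
    (W * trFst ((G ⊗ₖ (1 : Matrix n n ℂ)) * ρ)).trace = ((G ⊗ₖ W) * ρ).trace := by
  classical
  rw [trace_mul_trFst, ← mul_assoc, ← mul_kronecker_mul, one_mul, mul_one]

end PartialTrace

theorem sum_kronecker_sum {l m n p ι κ R : Type*} [CommSemiring R] (s : Finset ι) (t : Finset κ)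
    (f : ι → Matrix l m R) (g : κ → Matrix n p R) :
    (∑ i ∈ s, f i) ⊗ₖ (∑ j ∈ t, g j) = ∑ i ∈ s, ∑ j ∈ t, f i ⊗ₖ g j := by
  ext
  simp [Matrix.sum_apply, Finset.sum_mul_sum]

section Blocks

variable {X Y A B C : Type*} [Fintype X] [Fintype Y] {S : Protocol X Y A B C} {dA dB dE : ℕ}

theorem Device.sum_M [Fintype A] (D : Device S dA dB) (x : X) : ∑ a, D.M x a = 1 := by
  rw [← D.M_sum x]
  exact (Finset.sum_subset (Finset.subset_univ _) fun a _ h => D.M_zero x a h).symm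

variable [Fintype B]

theorem Device.sum_N (D : Device S dA dB) (y : Y) : ∑ b, D.N y b = 1 := by
  rw [← D.N_sum y]
  exact (Finset.sum_subset (Finset.subset_univ _) fun b _ h => D.N_zero y b h).symm

variable [DecidableEq C] (D : Device S dA dB) {σ : Matrix (Sys dA dB dE) (Sys dA dB dE) ℂ}

theorem Device.posSemidef_block (hσ : σ.PosSemidef) (a : A) (c : C) (x : X) (y : Y) (t : Bool) :
    (D.block σ a c x y t).PosSemidef :=
  posSemidef_sum _ fun b _ => posSemidef_trFst_kronecker_mul
    ((D.M_pos x a).kronecker (D.N_pos y b)) hσ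

theorem Device.sum_block [Fintype A] [Fintype C] (x : X) (y : Y) (t : Bool) :
    ∑ a, ∑ c, D.block σ a c x y t = trFst σ := by
  have hsum : ∑ a, ∑ b, D.M x a ⊗ₖ D.N y b = 1 := by
    rw [← sum_kronecker_sum, D.sum_M, D.sum_N, one_kronecker_one]
  calc ∑ a, ∑ c, D.block σ a c x y t
      = ∑ a, ∑ b, trFst (((D.M x a ⊗ₖ D.N y b) ⊗ₖ (1 : Matrix (Fin dE) (Fin dE) ℂ)) * σ) :=
        Finset.sum_congr rfl fun a _ => Finset.sum_fiberwise _ (fun b => S.test a b x y t) _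
    _ = trFst (((∑ a, ∑ b, D.M x a ⊗ₖ D.N y b) ⊗ₖ (1 : Matrix (Fin dE) (Fin dE) ℂ)) * σ) := by
        have hlin := sum_kronecker_sum Finset.univ (Finset.univ : Finset Unit)
          (fun ab : A × B => D.M x ab.1 ⊗ₖ D.N y ab.2)
          (fun _ => (1 : Matrix (Fin dE) (Fin dE) ℂ))
        simp only [Finset.univ_unique, Finset.sum_singleton, Fintype.sum_prod_type] at hlin
        simp only [hlin, Finset.sum_mul, trFst_sum]
    _ = trFst σ := by rw [hsum, one_kronecker_one, one_mul]

variable [DecidableEq X] [DecidableEq Y] [DecidableEq A]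

theorem Device.out_apply (a a' : A) (c c' : C) (x x' : X) (y y' : Y) (t t' : Bool)
    (e e' : Fin dE) :
    D.out σ (a, c, x, y, t, e) (a', c', x', y', t', e')
      = if a = a' ∧ c = c' ∧ x = x' ∧ y = y' ∧ t = t' then
          (S.prob x y t : ℂ) * D.block σ a c x y t e e' else 0 :=
  rfl

theorem Device.isHermitian_out (hσ : σ.PosSemidef) : (D.out σ).IsHermitian := by
  refine IsHermitian.ext ?_
  rintro ⟨a, c, x, y, t, e⟩ ⟨a', c', x', y', t', e'⟩
  rw [D.out_apply, D.out_apply]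
  by_cases h : a = a' ∧ c = c' ∧ x = x' ∧ y = y' ∧ t = t'
  · obtain ⟨rfl, rfl, rfl, rfl, rfl⟩ := h
    simp [(D.posSemidef_block hσ a c x y t).1.apply]
  · rw [if_neg h, if_neg (by tauto), star_zero]

theorem Device.isHermitian_outAnd (hσ : σ.PosSemidef) (c : C) : (D.outAnd σ c).IsHermitian :=
  (D.isHermitian_out hσ).submatrix fun r : A × (X × Y × Bool × Fin dE) => (r.1, c, r.2)

variable [Fintype A]

theorem Device.outAnd_mul_coordEmb (a : A) (c : C) (x : X) (y : Y) (t : Bool) :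
    D.outAnd σ c * coordEmb ℂ (fun e : Fin dE => (a, x, y, t, e))
      = coordEmb ℂ (fun e : Fin dE => (a, x, y, t, e))
        * ((S.prob x y t : ℂ) • D.block σ a c x y t) := by
  ext ⟨a', x', y', t', e'⟩ e
  rw [mul_coordEmb_apply, coordEmb_mul_apply, Device.outAnd, D.out_apply]
  by_cases h : a' = a ∧ x' = x ∧ y' = y ∧ t' = t
  · obtain ⟨rfl, rfl, rfl, rfl⟩ := h
    simp
  · rw [if_neg (by tauto), Finset.sum_eq_zero fun i _ => if_neg (by simp; tauto)]

variable [Fintype C]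

theorem Device.isHermitian_outXYTE (hσ : σ.PosSemidef) : (D.outXYTE σ).IsHermitian := by
  refine IsHermitian.ext fun r r' => ?_
  simp only [Device.outXYTE, star_sum, (D.isHermitian_out hσ).apply]

theorem Device.outXYTE_mul_coordEmb (x : X) (y : Y) (t : Bool) :
    D.outXYTE σ * coordEmb ℂ (fun e : Fin dE => (x, y, t, e))
      = coordEmb ℂ (fun e : Fin dE => (x, y, t, e)) * ((S.prob x y t : ℂ) • trFst σ) := by
  ext ⟨x', y', t', e'⟩ e
  rw [mul_coordEmb_apply, coordEmb_mul_apply]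
  simp only [Device.outXYTE, D.out_apply, true_and]
  by_cases h : x' = x ∧ y' = y ∧ t' = t
  · obtain ⟨rfl, rfl, rfl⟩ := h
    simp [← D.sum_block x' y' t', Matrix.sum_apply, Finset.mul_sum]
  · rw [Finset.sum_eq_zero fun i _ => if_neg (by simp; tauto)]
    simp [h]

theorem Device.petz_eq (hσ : σ.PosSemidef) (α : ℝ) (c : C) :
    D.petz σ α c = ∑ x, ∑ y, ∑ t, ∑ a,
      (mpow ((S.prob x y t : ℂ) • D.block σ a c x y t) α
        * mpow ((S.prob x y t : ℂ) • trFst σ) (1 - α)).trace.re := by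
  have hdiag (a : A) (x : X) (y : Y) (t : Bool) (e : Fin dE) :
      (mpow (D.outAnd σ c) α * ((1 : Matrix A A ℂ) ⊗ₖ mpow (D.outXYTE σ) (1 - α)))
        (a, x, y, t, e) (a, x, y, t, e)
      = (mpow ((S.prob x y t : ℂ) • D.block σ a c x y t) α
        * mpow ((S.prob x y t : ℂ) • trFst σ) (1 - α)) e e := by
    have hprob : (0 : ℂ) ≤ S.prob x y t := by exact_mod_cast S.prob_nonneg x y t
    have hAnd : mpow (D.outAnd σ c) α * coordEmb ℂ (fun e : Fin dE => (a, x, y, t, e))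
        = coordEmb ℂ (fun e : Fin dE => (a, x, y, t, e))
          * mpow ((S.prob x y t : ℂ) • D.block σ a c x y t) α :=
      cfc_mul_eq_mul_cfc (D.isHermitian_outAnd hσ c)
        ((D.posSemidef_block hσ a c x y t).smul hprob).1 (D.outAnd_mul_coordEmb a c x y t) _
    have hXYTE : mpow (D.outXYTE σ) (1 - α) * coordEmb ℂ (fun e : Fin dE => (x, y, t, e))
        = coordEmb ℂ (fun e : Fin dE => (x, y, t, e))
          * mpow ((S.prob x y t : ℂ) • trFst σ) (1 - α) :=
      cfc_mul_eq_mul_cfc (D.isHermitian_outXYTE hσ) ((posSemidef_trFst hσ).smul hprob).1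
        (D.outXYTE_mul_coordEmb x y t) _
    refine apply_of_mul_coordEmb (φ := fun e => (a, x, y, t, e)) (fun e e' h => by simpa using h)
      ?_ e e
    rw [Matrix.mul_assoc, one_kronecker_mul_coordEmb hXYTE, ← Matrix.mul_assoc, hAnd,
      Matrix.mul_assoc]
  rw [Device.petz, trace, Fintype.sum_prod_type]
  simp only [Fintype.sum_prod_type, diag_apply, hdiag, Complex.re_sum, trace]
  rw [Finset.sum_comm]
  refine Finset.sum_congr rfl fun x _ => ?_
  rw [Finset.sum_comm]
  refine Finset.sum_congr rfl fun y _ => ?_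
  rw [Finset.sum_comm]

end Blocks

section Gram

variable {n : Type*} [Fintype n]

/-- The real part of the expectation of `T` in the (not necessarily normalized) state `σ`. It is
the linear functional on operators that turns a strategy into moments. -/
def expect (σ : Matrix n n ℂ) : Matrix n n ℂ →ₗ[ℝ] ℝ where
  toFun T := (T * σ).trace.re
  map_add' S T := by rw [add_mul, trace_add, Complex.add_re]
  map_smul' r T := by rw [Matrix.smul_mul, trace_smul, Complex.smul_re]; rfl

theorem expect_apply (σ T : Matrix n n ℂ) : expect σ T = (T * σ).trace.re := rfl

open scoped MatrixOrder Matrix.Norms.L2Operator in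
theorem expect_nonneg {σ T : Matrix n n ℂ} (hσ : σ.PosSemidef) (hT : T.PosSemidef) :
    0 ≤ expect σ T := by
  classical
  obtain ⟨K, rfl⟩ := CStarAlgebra.nonneg_iff_eq_star_mul_self.1 hσ.nonneg
  rw [expect_apply, ← mul_assoc, trace_mul_comm, ← mul_assoc]
  exact (Complex.le_def.1 (hT.mul_mul_conjTranspose_same K).trace_nonneg).1

theorem expect_conjTranspose {σ : Matrix n n ℂ} (hσ : σ.IsHermitian) (T : Matrix n n ℂ) :
    expect σ Tᴴ = expect σ T := by
  rw [expect_apply, trace_mul_comm, ← hσ.eq, ← conjTranspose_mul, trace_conjTranspose, hσ.eq,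
    RCLike.star_def, Complex.conj_re, expect_apply]

theorem posSemidef_expect_conjTranspose_mul_mul {ι : Type*} [Finite ι] {σ G : Matrix n n ℂ}
    (hσ : σ.PosSemidef) (hG : G.PosSemidef) (T : ι → Matrix n n ℂ) :
    (of fun u v => expect σ ((T u)ᴴ * G * T v)).PosSemidef := by
  cases nonempty_fintype ι
  refine PosSemidef.of_dotProduct_mulVec_nonneg (IsHermitian.ext fun u v => ?_) fun x => ?_
  · rw [of_apply, of_apply, star_trivial, ← expect_conjTranspose hσ.1]
    simp only [conjTranspose_mul, conjTranspose_conjTranspose, hG.1.eq, mul_assoc]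
  · have hexpand : (∑ u, x u • T u)ᴴ * G * (∑ v, x v • T v)
        = ∑ u, ∑ v, x u • x v • ((T u)ᴴ * G * T v) := by
      simp only [conjTranspose_sum, Finset.sum_mul, Finset.mul_sum, conjTranspose_smul,
        star_trivial, Matrix.smul_mul, Matrix.mul_smul]
      rw [Finset.sum_comm]
      exact Finset.sum_congr rfl fun u _ => Finset.sum_congr rfl fun v _ => smul_comm _ _ _
    have hnonneg := expect_nonneg hσ (hG.conjTranspose_mul_mul_same (∑ u, x u • T u))
    simp only [hexpand, map_sum, map_smul, smul_eq_mul] at hnonneg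
    simpa [dotProduct, mulVec, Finset.mul_sum, mul_comm, mul_left_comm] using hnonneg

end Gram

section BlockMatrices

variable {R : Type*} [Ring R] [PartialOrder R] [StarRing R] [AddLeftMono R]

theorem posSemidef_fromBlocks_zero {k l : Type*} [Finite k] [Finite l] {P : Matrix k k R}
    {Q : Matrix l l R} (hP : P.PosSemidef) (hQ : Q.PosSemidef) :
    (fromBlocks P 0 0 Q).PosSemidef := by
  cases nonempty_fintype k
  cases nonempty_fintype l
  refine PosSemidef.of_dotProduct_mulVec_nonneg ?_ fun x => ?_
  · exact hP.1.fromBlocks conjTranspose_zero hQ.1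
  · rw [fromBlocks_mulVec]
    simpa [dotProduct] using add_nonneg (hP.dotProduct_mulVec_nonneg (x ∘ Sum.inl))
      (hQ.dotProduct_mulVec_nonneg (x ∘ Sum.inr))

theorem posSemidef_blockDiagonal' {o : Type*} [Finite o] [DecidableEq o] {κ : o → Type*}
    [∀ i, Finite (κ i)] {P : ∀ i, Matrix (κ i) (κ i) R} (hP : ∀ i, (P i).PosSemidef) :
    (blockDiagonal' P).PosSemidef := by
  cases nonempty_fintype o
  have := fun i => Fintype.ofFinite (κ i)
  refine PosSemidef.of_dotProduct_mulVec_nonneg ?_ fun x => ?_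
  · rw [IsHermitian, blockDiagonal'_conjTranspose]
    exact congrArg _ (funext fun i => (hP i).1)
  · have hsum : star x ⬝ᵥ blockDiagonal' P *ᵥ x
        = ∑ i, star (fun j => x ⟨i, j⟩) ⬝ᵥ P i *ᵥ fun j => x ⟨i, j⟩ := by
      simp only [dotProduct, mulVec, Fintype.sum_sigma]
      refine Finset.sum_congr rfl fun i _ => Finset.sum_congr rfl fun j _ => ?_
      rw [Finset.sum_eq_single i (fun i' _ hi' => Finset.sum_eq_zero fun j' _ => by
        rw [blockDiagonal'_apply_ne _ _ _ hi'.symm, zero_mul]) (by simp)]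
      simp [blockDiagonal'_apply_eq]
    rw [hsum]
    exact Finset.sum_nonneg fun i _ => (hP i).dotProduct_mulVec_nonneg _

end BlockMatrices

section TensorEmbeddings

variable {m n : Type*} [Fintype m] [DecidableEq m] [Fintype n] [DecidableEq n]

/-- The operator `V ⊗ 1` on a composite system that acts as `V` on the first factor. -/
def onFst (m n : Type*) [Fintype m] [DecidableEq m] [Fintype n] [DecidableEq n] :
    Matrix m m ℂ →ₐ[ℝ] Matrix (m × n) (m × n) ℂ where
  toFun V := V ⊗ₖ 1
  map_one' := one_kronecker_one
  map_zero' := zero_kronecker _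
  map_mul' V W := by rw [← mul_kronecker_mul, one_mul]
  map_add' V W := add_kronecker _ _ _
  commutes' r := by
    rw [Algebra.algebraMap_eq_smul_one, Algebra.algebraMap_eq_smul_one, smul_kronecker,
      one_kronecker_one]

/-- The operator `1 ⊗ W` on a composite system that acts as `W` on the second factor. -/
def onSnd (m n : Type*) [Fintype m] [DecidableEq m] [Fintype n] [DecidableEq n] :
    Matrix n n ℂ →ₐ[ℝ] Matrix (m × n) (m × n) ℂ where
  toFun W := 1 ⊗ₖ W
  map_one' := one_kronecker_one
  map_zero' := kronecker_zero _
  map_mul' V W := by rw [← mul_kronecker_mul, one_mul]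
  map_add' V W := kronecker_add _ _ _
  commutes' r := by
    rw [Algebra.algebraMap_eq_smul_one, Algebra.algebraMap_eq_smul_one, kronecker_smul,
      one_kronecker_one]

theorem onFst_apply (V : Matrix m m ℂ) : onFst m n V = V ⊗ₖ 1 := rfl

theorem onSnd_apply (W : Matrix n n ℂ) : onSnd m n W = 1 ⊗ₖ W := rfl

theorem onFst_mul_onSnd (V : Matrix m m ℂ) (W : Matrix n n ℂ) :
    onFst m n V * onSnd m n W = V ⊗ₖ W := by
  rw [onFst_apply, onSnd_apply, ← mul_kronecker_mul, one_mul, mul_one]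

theorem commute_onFst_onSnd (V : Matrix m m ℂ) (W : Matrix n n ℂ) :
    Commute (onFst m n V) (onSnd m n W) := by
  rw [Commute, SemiconjBy, onFst_mul_onSnd, onFst_apply, onSnd_apply, ← mul_kronecker_mul,
    one_mul, mul_one]

theorem posSemidef_onFst {V : Matrix m m ℂ} (hV : V.PosSemidef) : (onFst m n V).PosSemidef :=
  hV.kronecker PosSemidef.one

theorem posSemidef_onSnd {W : Matrix n n ℂ} (hW : W.PosSemidef) : (onSnd m n W).PosSemidef :=
  PosSemidef.one.kronecker hW

theorem onFst_conjTranspose (V : Matrix m m ℂ) : onFst m n Vᴴ = (onFst m n V)ᴴ := by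
  rw [onFst_apply, onFst_apply, conjTranspose_kronecker, conjTranspose_one]

theorem onSnd_conjTranspose (W : Matrix n n ℂ) : onSnd m n Wᴴ = (onSnd m n W)ᴴ := by
  rw [onSnd_apply, onSnd_apply, conjTranspose_kronecker, conjTranspose_one]

theorem expect_onFst_mul_onSnd (σ : Matrix (m × n) (m × n) ℂ) (V : Matrix m m ℂ)
    (W : Matrix n n ℂ) :
    expect σ (onFst m n V * onSnd m n W)
      = (W * trFst ((V ⊗ₖ (1 : Matrix n n ℂ)) * σ)).trace.re := by
  rw [onFst_mul_onSnd, expect_apply, trace_mul_trFst_kronecker]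

theorem expect_onSnd (σ : Matrix (m × n) (m × n) ℂ) (W : Matrix n n ℂ) :
    expect σ (onSnd m n W) = (W * trFst σ).trace.re := by
  rw [onSnd_apply, expect_apply, trace_mul_trFst]

end TensorEmbeddings

section Representation

variable {X Y A B C : Type*} [Fintype X] [Fintype Y] {S : Protocol X Y A B C} {dA dB dE m : ℕ}

/-- The operator on `Q_A Q_B E` that a variable stands for in a strategy, which consists of the
measurements of `D` and of operators `Z` on `E`. -/
def letterRep (D : Device S dA dB)
    (Z : C → A → X → Y → Bool → Fin m → Matrix (Fin dE) (Fin dE) ℂ) :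
    Letter X Y A B C m → Matrix (Sys dA dB dE) (Sys dA dB dE) ℂ
  | .M x a => onFst _ _ (onFst _ _ (D.M x a))
  | .N y b => onFst _ _ (onSnd _ _ (D.N y b))
  | .Z c a x y t i => onSnd _ _ (Z c a x y t i)
  | .Zdag c a x y t i => onSnd _ _ (Z c a x y t i)ᴴ

/-- The operator that a word stands for, see `letterRep`. -/
def wordRep (D : Device S dA dB)
    (Z : C → A → X → Y → Bool → Fin m → Matrix (Fin dE) (Fin dE) ℂ) :
    Word X Y A B C m →* Matrix (Sys dA dB dE) (Sys dA dB dE) ℂ :=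
  FreeMonoid.lift (letterRep D Z)

/-- The operator that a polynomial stands for, see `letterRep`: the evaluation of the polynomial at
a strategy. -/
def polyRep (D : Device S dA dB)
    (Z : C → A → X → Y → Bool → Fin m → Matrix (Fin dE) (Fin dE) ℂ) :
    NCPoly X Y A B C m →ₐ[ℝ] Matrix (Sys dA dB dE) (Sys dA dB dE) ℂ :=
  MonoidAlgebra.lift ℝ _ _ (wordRep D Z)

variable (D : Device S dA dB) (Z : C → A → X → Y → Bool → Fin m → Matrix (Fin dE) (Fin dE) ℂ)

theorem polyRep_var (l : Letter X Y A B C m) : polyRep D Z (var l) = letterRep D Z l := by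
  rw [polyRep, var, MonoidAlgebra.lift_of, wordRep, FreeMonoid.lift_eval_of]

theorem letterRep_adj (l : Letter X Y A B C m) :
    letterRep D Z l.adj = (letterRep D Z l)ᴴ := by
  cases l <;> simp only [letterRep, Letter.adj, ← onFst_conjTranspose, ← onSnd_conjTranspose,
    conjTranspose_conjTranspose, (D.M_pos _ _).1.eq, (D.N_pos _ _).1.eq]

theorem wordRep_wstar (v : Word X Y A B C m) : wordRep D Z (wstar v) = (wordRep D Z v)ᴴ := by
  induction v using FreeMonoid.recOn with
  | one => simp [wstar]
  | of_mul l v ih =>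
    have hwstar : wstar (FreeMonoid.of l * v) = wstar v * FreeMonoid.of l.adj := by
      simp [wstar, FreeMonoid.ofList_append]
    rw [hwstar, map_mul, map_mul, conjTranspose_mul, ih, wordRep, FreeMonoid.lift_eval_of,
      FreeMonoid.lift_eval_of, letterRep_adj]

theorem posSemidef_letterRep_posLetter (g : (X × A) ⊕ (Y × B)) :
    (letterRep D Z (posLetter m g)).PosSemidef := by
  rcases g with ⟨x, a⟩ | ⟨y, b⟩
  · exact posSemidef_onFst (posSemidef_onFst (D.M_pos x a))
  · exact posSemidef_onFst (posSemidef_onSnd (D.N_pos y b))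

theorem polyRep_eq_zero_of_eqConstraint {r : NCPoly X Y A B C m} (h : EqConstraint S m r) :
    polyRep D Z r = 0 := by
  cases h with
  | sumM x =>
    simp only [map_sub, map_sum, map_one, polyRep_var, letterRep]
    rw [← map_sum, ← map_sum, D.M_sum, map_one, map_one, sub_self]
  | sumN y =>
    simp only [map_sub, map_sum, map_one, polyRep_var, letterRep]
    rw [← map_sum, ← map_sum, D.N_sum, map_one, map_one, sub_self]
  | outM x a h => rw [polyRep_var, letterRep, D.M_zero x a h, map_zero, map_zero]
  | outN y b h => rw [polyRep_var, letterRep, D.N_zero y b h, map_zero, map_zero]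
  | commMN x a y b =>
    rw [map_sub, map_mul, map_mul, polyRep_var, polyRep_var, sub_eq_zero]
    exact (commute_onFst_onSnd (D.M x a) (D.N y b)).map (onFst _ _)
  | _ =>
    rw [map_sub, map_mul, map_mul, polyRep_var, polyRep_var, sub_eq_zero]
    exact commute_onFst_onSnd _ _

theorem polyRep_eq_zero_of_mem_span {r : NCPoly X Y A B C m}
    (h : r ∈ TwoSidedIdeal.span {s | EqConstraint S m s}) : polyRep D Z r = 0 :=
  (TwoSidedIdeal.mem_ker _).1 <| TwoSidedIdeal.span_le.2
    (fun _ hs => (TwoSidedIdeal.mem_ker _).2 (polyRep_eq_zero_of_eqConstraint D Z hs)) h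

theorem polyRep_polyP (α : ℝ) (nd w : Fin m → ℝ) (a : A) (c : C) (x : X) (y : Y) (t : Bool) :
    polyRep D Z (polyP α nd w c a x y t)
      = onSnd _ _ (1 + sinCoeff α • ∑ i, (w i / nd i) • (1 + Z c a x y t i
        + (Z c a x y t i)ᴴ + (1 - nd i) • ((Z c a x y t i)ᴴ * Z c a x y t i))) := by
  simp only [polyP, sinCoeff, map_add, map_smul, map_sum, map_mul, map_one, polyRep_var, letterRep]

theorem polyRep_polyQ (α : ℝ) (w : Fin m → ℝ) (a : A) (c : C) (x : X) (y : Y) (t : Bool) :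
    polyRep D Z (polyQ α w c a x y t)
      = onSnd _ _ (sinCoeff α • ∑ i, w i • (Z c a x y t i * (Z c a x y t i)ᴴ)) := by
  simp only [polyQ, sinCoeff, map_smul, map_sum, map_mul, polyRep_var, letterRep]

theorem polyRep_var_M_mul_var_N (a : A) (b : B) (x : X) (y : Y) :
    polyRep D Z (var (.M x a) * var (.N y b)) = onFst _ _ (D.M x a ⊗ₖ D.N y b) := by
  rw [map_mul, polyRep_var, polyRep_var, letterRep, letterRep, ← map_mul, onFst_mul_onSnd]

variable [Fintype B] [DecidableEq C] (σ : Matrix (Sys dA dB dE) (Sys dA dB dE) ℂ)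

theorem Device.block_eq_sum_outB (a : A) (c : C) (x : X) (y : Y) (t : Bool) :
    D.block σ a c x y t = ∑ b ∈ S.outB y with S.test a b x y t = c,
      trFst (((D.M x a ⊗ₖ D.N y b) ⊗ₖ (1 : Matrix (Fin dE) (Fin dE) ℂ)) * σ) := by
  refine (Finset.sum_subset (Finset.filter_subset_filter _ (Finset.subset_univ _))
    fun b hb hb' => ?_).symm
  have hbB : b ∉ S.outB y := fun h => hb' (Finset.mem_filter.2 ⟨h, (Finset.mem_filter.1 hb).2⟩)
  rw [D.N_zero y b hbB, kronecker_zero, zero_kronecker, zero_mul, trFst_zero]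

theorem Device.block_eq_zero {a : A} {c : C} {x : X} {y : Y} {t : Bool}
    (h : ¬(a ∈ S.outA x ∧ ∃ b ∈ S.outB y, S.test a b x y t = c)) : D.block σ a c x y t = 0 := by
  rw [D.block_eq_sum_outB]
  refine Finset.sum_eq_zero fun b hb => ?_
  have ha : a ∉ S.outA x := fun ha => h ⟨ha, b, Finset.mem_filter.1 hb⟩
  rw [D.M_zero x a ha, zero_kronecker, zero_kronecker, zero_mul, trFst_zero]

theorem expect_polyRep_summand (α : ℝ) (nd w : Fin m → ℝ) (a : A) (c : C) (x : X) (y : Y)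
    (t : Bool) :
    expect σ (polyRep D Z ((∑ b ∈ S.outB y with S.test a b x y t = c,
          var (.M x a) * var (.N y b) * polyP α nd w c a x y t) + polyQ α w c a x y t))
      = matrixBound α nd w (D.block σ a c x y t) (trFst σ) (Z c a x y t) := by
  have hblock (W : Matrix (Fin dE) (Fin dE) ℂ) : ∑ b ∈ S.outB y with S.test a b x y t = c,
      expect σ (onFst _ _ (D.M x a ⊗ₖ D.N y b) * onSnd _ _ W)
      = (W * D.block σ a c x y t).trace.re := by
    simp only [expect_onFst_mul_onSnd, D.block_eq_sum_outB, Finset.mul_sum, trace_sum,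
      Complex.re_sum]
  have hproduct (b : B) := (map_mul (polyRep D Z) (var (.M x a) * var (.N y b))
    (polyP α nd w c a x y t)).trans
      (congrArg₂ _ (polyRep_var_M_mul_var_N D Z a b x y) (polyRep_polyP D Z α nd w a c x y t))
  rw [map_add, map_sum, polyRep_polyQ, map_add, map_sum, expect_onSnd]
  simp only [hproduct, hblock]
  rw [add_mul, one_mul, trace_add, Complex.add_re, matrixBound]
  simp only [Matrix.smul_mul, Finset.sum_mul, trace_smul, trace_sum, Complex.smul_re,
    Complex.re_sum, smul_eq_mul, Complex.coe_smul]

theorem expect_polyRep_objective (α : ℝ) (nd w : Fin m → ℝ) (c : C) :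
    expect σ (polyRep D Z (objective S α nd w c))
      = ∑ x, ∑ y, ∑ t, S.prob x y t *
        ∑ a ∈ S.outA x with ∃ b ∈ S.outB y, S.test a b x y t = c,
          matrixBound α nd w (D.block σ a c x y t) (trFst σ) (Z c a x y t) := by
  simp only [← expect_polyRep_summand, ← map_sum, ← smul_eq_mul, ← map_smul]
  rfl

end Representation

section ObjectiveBound

theorem matrixBound_smul {m : ℕ} {n : Type*} [Fintype n] [DecidableEq n] (α : ℝ)
    (nd w : Fin m → ℝ) (ρ τ : Matrix n n ℂ) (Z : Fin m → Matrix n n ℂ) (r : ℝ) :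
    matrixBound α nd w ((r : ℂ) • ρ) ((r : ℂ) • τ) Z = r * matrixBound α nd w ρ τ Z := by
  simp only [matrixBound, Matrix.mul_smul, trace_smul, smul_eq_mul, Complex.re_ofReal_mul, mul_add,
    Finset.mul_sum, mul_left_comm r]

theorem mpow_zero {n : Type*} [Fintype n] [DecidableEq n] {r : ℝ} (hr : r ≠ 0) :
    mpow (0 : Matrix n n ℂ) r = 0 := by
  rw [mpow, cfc_apply_zero, Real.zero_rpow hr, map_zero]

variable {X Y A B C : Type*} [Fintype X] [Fintype Y] [Fintype A] [Fintype B] [Fintype C]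
  [DecidableEq X] [DecidableEq Y] [DecidableEq A] [DecidableEq C]
  {S : Protocol X Y A B C} {dA dB dE m : ℕ}

theorem exists_petz_le_expect (D : Device S dA dB) {σ : Matrix (Sys dA dB dE) (Sys dA dB dE) ℂ}
    (hσ : σ.PosSemidef) {α : ℝ} (hα : α ∈ Set.Ioo (1 : ℝ) 2) {nd w : Fin m → ℝ}
    (h : IsGaussRadauJacobi α m nd w) :
    ∃ Z : C → A → X → Y → Bool → Fin m → Matrix (Fin dE) (Fin dE) ℂ, ∀ c,
      D.petz σ α c ≤ expect σ (polyRep D Z (objective S α nd w c)) := by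
  have hprob (x y t) : (0 : ℂ) ≤ S.prob x y t := by exact_mod_cast S.prob_nonneg x y t
  choose Z hZ using fun c a x y t => exists_le_matrixBound hα h
    ((D.posSemidef_block hσ a c x y t).smul (hprob x y t))
    ((posSemidef_trFst hσ).smul (hprob x y t))
  refine ⟨Z, fun c => ?_⟩
  rw [D.petz_eq hσ, expect_polyRep_objective]
  refine Finset.sum_le_sum fun x _ => Finset.sum_le_sum fun y _ => Finset.sum_le_sum fun t _ => ?_
  rw [Finset.mul_sum, ← Finset.sum_subset (Finset.subset_univ
    ((S.outA x).filter fun a => ∃ b ∈ S.outB y, S.test a b x y t = c)) fun a _ ha => ?_]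
  · exact Finset.sum_le_sum fun a _ => (hZ c a x y t).trans_eq (matrixBound_smul ..)
  · rw [D.block_eq_zero σ fun h => ha (Finset.mem_filter.2 h), smul_zero,
      mpow_zero (by linarith [hα.1]), zero_mul, trace_zero, Complex.zero_re]

end ObjectiveBound

namespace NPARelaxation

variable {X Y A B C : Type*} [Fintype X] [Fintype Y] [DecidableEq C] {S : Protocol X Y A B C}
  {dA dB dE m : ℕ} {α : ℝ} {nd w : Fin m → ℝ} (R : NPARelaxation S α nd w)

theorem isLinearMap_riesz (p : NCPoly X Y A B C m) : IsLinearMap ℝ fun y => R.riesz y p where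
  map_add y y' := by
    simp only [riesz, Pi.add_apply, mul_add, Finset.sum_add_distrib]
  map_smul r y := by
    simp only [riesz, Pi.smul_apply, smul_eq_mul, mul_left_comm _ r, Finset.mul_sum]

section Moments

variable (D : Device S dA dB) (Z : C → A → X → Y → Bool → Fin m → Matrix (Fin dE) (Fin dE) ℂ)
  (σ : Matrix (Sys dA dB dE) (Sys dA dB dE) ℂ)

/-- The moments of the strategy that consists of the devices `D`, the operators `Z` and the state
`σ`. They are the point of the relaxation that the strategy gives rise to. -/
def moments (v : R.Idx) : ℝ := expect σ (wordRep D Z v.1)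

theorem riesz_moments {r : NCPoly X Y A B C m} (hr : r.coeff.support ⊆ R.mono) :
    R.riesz (R.moments D Z σ) r = expect σ (polyRep D Z r) := by
  rw [polyRep, MonoidAlgebra.lift_apply, Finsupp.sum, map_sum]
  simp only [map_smul, smul_eq_mul]
  rw [Finset.sum_subset hr fun v _ hv => by rw [Finsupp.notMem_support_iff.1 hv, zero_mul],
    ← Finset.sum_coe_sort R.mono]
  rfl

theorem riesz_moments_eq_zero {r : NCPoly X Y A B C m} (hr : r ∈ R.eqs) :
    R.riesz (R.moments D Z σ) r = 0 := by
  rw [R.riesz_moments D Z σ (R.eqs_mono r hr),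
    polyRep_eq_zero_of_mem_span D Z (R.eqs_ideal r hr), map_zero]

theorem moments_one {σ : Matrix (Sys dA dB dE) (Sys dA dB dE) ℂ} (hσ : IsState σ) :
    R.moments D Z σ R.one = 1 := by
  change expect σ (wordRep D Z 1) = 1
  rw [map_one, expect_apply, one_mul, hσ.2, Complex.one_re]

variable [Finite A] [Finite B] [DecidableEq X] [DecidableEq Y] [DecidableEq A] [DecidableEq B]

theorem posSemidef_momentMatrix_moments {σ : Matrix (Sys dA dB dE) (Sys dA dB dE) ℂ}
    (hσ : σ.PosSemidef) : (R.momentMatrix (R.moments D Z σ)).PosSemidef := by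
  classical
  have heqs : (fun r : {r // r ∈ R.eqs} => R.riesz (R.moments D Z σ) r) = 0 :=
    funext fun r => R.riesz_moments_eq_zero D Z σ r.2
  refine posSemidef_fromBlocks_zero ?_ (posSemidef_fromBlocks_zero
    (posSemidef_blockDiagonal' fun g => ?_) (posSemidef_fromBlocks_zero ?_ ?_))
  · convert posSemidef_expect_conjTranspose_mul_mul hσ PosSemidef.one
      fun v : {v // v ∈ R.basis} => wordRep D Z v.1 using 4 with u v
    rw [moments, map_mul (wordRep D Z), wordRep_wstar, mul_one]
  · convert posSemidef_expect_conjTranspose_mul_mul hσ (posSemidef_letterRep_posLetter D Z g)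
      fun v : {v // v ∈ R.loc g} => wordRep D Z v.1 using 4 with u v
    rw [moments, map_mul (wordRep D Z), map_mul (wordRep D Z), wordRep_wstar, wordRep,
      FreeMonoid.lift_eval_of]
  · exact PosSemidef.diagonal heqs.ge
  · exact PosSemidef.diagonal fun r => by simp [congrFun heqs r]

end Moments

section MomentMatrix

variable [DecidableEq X] [DecidableEq Y] [DecidableEq A] [DecidableEq B]

theorem isLinearMap_momentMatrix : IsLinearMap ℝ R.momentMatrix where
  map_add y y' := by
    simp only [momentMatrix, fromBlocks_add, ← blockDiagonal'_add, diagonal_add, add_zero,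
      (R.isLinearMap_riesz _).map_add, neg_add]
    rfl
  map_smul r y := by
    simp only [momentMatrix, fromBlocks_smul, ← blockDiagonal'_smul, ← diagonal_smul, smul_zero,
      (R.isLinearMap_riesz _).map_smul, ← smul_neg]
    rfl

open Classical in
/-- The coefficient matrices `E_i` of `M(y) = ∑ y_i E_i`. -/
def coeffMatrix (i : R.Idx) : Matrix R.Row R.Row ℝ :=
  R.momentMatrix fun j => if i = j then 1 else 0

theorem momentMatrix_eq_sum (y : R.Idx → ℝ) :
    R.momentMatrix y = ∑ i, y i • R.coeffMatrix i := by
  classical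
  exact (R.isLinearMap_momentMatrix.mk' _).pi_apply_eq_sum_univ y

theorem convex_feasible :
    Convex ℝ {y : R.Idx → ℝ | y R.one = 1 ∧ (R.momentMatrix y).PosSemidef} := by
  rintro y ⟨hy, hpos⟩ y' ⟨hy', hpos'⟩ l l' hl hl' hll
  refine ⟨by simp [hy, hy', hll], ?_⟩
  rw [R.isLinearMap_momentMatrix.map_add, R.isLinearMap_momentMatrix.map_smul,
    R.isLinearMap_momentMatrix.map_smul]
  exact (hpos.smul hl).add (hpos'.smul hl')

end MomentMatrix

end NPARelaxation

section RelEnt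

/-- The effective domain of `relEntTerm`, the set of the `(a, b)` at which it is finite. -/
def relEntDom : Set (ℝ × ℝ) := {z | 0 ≤ z.1 ∧ 0 ≤ z.2 ∧ (z.2 = 0 → z.1 = 0)}

theorem relEntTerm_of_mem {a b : ℝ} (h : (a, b) ∈ relEntDom) :
    relEntTerm a b = ((a * Real.logb 2 (a / b) : ℝ) : EReal) := by
  obtain ⟨ha, hb, hab⟩ := h
  rcases ha.eq_or_lt' with rfl | ha
  · simp [relEntTerm, hb]
  · rw [relEntTerm, if_pos ⟨ha, hb.lt_of_ne' (mt hab ha.ne')⟩]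

theorem relEntTerm_of_notMem {a b : ℝ} (h : (a, b) ∉ relEntDom) : relEntTerm a b = ⊤ := by
  rw [relEntTerm, if_neg fun hab => h ⟨hab.1.le, hab.2.le, fun hb => absurd hb hab.2.ne'⟩,
    if_neg fun hab => h ⟨hab.1.ge, hab.2, fun _ => hab.1⟩]

theorem relEntTerm_ne_bot (a b : ℝ) : relEntTerm a b ≠ ⊥ := by
  by_cases h : (a, b) ∈ relEntDom
  · rw [relEntTerm_of_mem h]; exact EReal.coe_ne_bot _
  · rw [relEntTerm_of_notMem h]; exact top_ne_bot

theorem antitone_relEntTerm (a : ℝ) : Antitone (relEntTerm a) := by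
  intro b b' hbb'
  by_cases h : (a, b) ∈ relEntDom
  · obtain ⟨ha, hb, hab⟩ := id h
    have h' : (a, b') ∈ relEntDom :=
      ⟨ha, hb.trans hbb', fun hb' => hab (le_antisymm (hbb'.trans_eq hb') hb)⟩
    rw [relEntTerm_of_mem h, relEntTerm_of_mem h', EReal.coe_le_coe_iff]
    rcases ha.eq_or_lt' with rfl | ha
    · simp
    · have hb : 0 < b := hb.lt_of_ne' (mt hab ha.ne')
      exact mul_le_mul_of_nonneg_left (Real.logb_le_logb_of_le one_lt_two
        (div_pos ha (hb.trans_le hbb')) (div_le_div_of_nonneg_left ha.le hb hbb')) ha.le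
  · exact le_top.trans_eq (relEntTerm_of_notMem h).symm

variable {C : Type*} [Fintype C]

theorem antitone_relEnt (q : C → ℝ) : Antitone (relEnt q) := fun _ _ h =>
  Finset.sum_le_sum fun c _ => antitone_relEntTerm (q c) (h c)

theorem relEnt_of_forall_mem {q f : C → ℝ} (h : ∀ c, (q c, f c) ∈ relEntDom) :
    relEnt q f = ((∑ c, q c * Real.logb 2 (q c / f c) : ℝ) : EReal) := by
  have hcoe : ((∑ c, q c * Real.logb 2 (q c / f c) : ℝ) : EReal)
      = ∑ c, ((q c * Real.logb 2 (q c / f c) : ℝ) : EReal) :=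
    map_sum (⟨⟨Real.toEReal, rfl⟩, EReal.coe_add⟩ : ℝ →+ EReal) _ _
  rw [hcoe]
  exact Finset.sum_congr rfl fun c _ => relEntTerm_of_mem (h c)

theorem relEnt_of_notMem {q f : C → ℝ} {c : C} (h : (q c, f c) ∉ relEntDom) :
    relEnt q f = ⊤ := by
  classical
  have hbot : ∑ c' ∈ Finset.univ.erase c, relEntTerm (q c') (f c') ≠ ⊥ :=
    Finset.sum_induction _ (· ≠ ⊥) (fun a b ha hb => by simp [EReal.add_eq_bot_iff, ha, hb])
      EReal.zero_ne_bot fun c' _ => relEntTerm_ne_bot _ _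
  rw [relEnt, ← Finset.add_sum_erase _ _ (Finset.mem_univ c), relEntTerm_of_notMem h,
    EReal.top_add_of_ne_bot hbot]

theorem mul_relEnt_le_coe_iff {r : ℝ} (hr : 0 < r) (q f : C → ℝ) (z : ℝ) :
    (r : EReal) * relEnt q f ≤ (z : EReal) ↔ (∀ c, (q c, f c) ∈ relEntDom) ∧
      r * ∑ c, q c * Real.logb 2 (q c / f c) ≤ z := by
  by_cases h : ∀ c, (q c, f c) ∈ relEntDom
  · rw [relEnt_of_forall_mem h, ← EReal.coe_mul, EReal.coe_le_coe_iff, and_iff_right h]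
  · obtain ⟨c, hc⟩ := not_forall.1 h
    rw [relEnt_of_notMem hc, EReal.coe_mul_top_of_pos hr]
    simp [h]

theorem convex_relEntDom : Convex ℝ relEntDom := by
  rintro ⟨a, b⟩ ⟨ha, hb, hab⟩ ⟨a', b'⟩ ⟨ha', hb', hab'⟩ l l' hl hl' -
  refine ⟨add_nonneg (mul_nonneg hl ha) (mul_nonneg hl' ha'),
    add_nonneg (mul_nonneg hl hb) (mul_nonneg hl' hb'), fun hzero => ?_⟩
  have hsummands := (add_eq_zero_iff_of_nonneg (mul_nonneg hl hb) (mul_nonneg hl' hb')).1 hzero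
  have hla : l * a = 0 := mul_eq_zero.2 ((mul_eq_zero.1 hsummands.1).imp_right hab)
  have hla' : l' * a' = 0 := mul_eq_zero.2 ((mul_eq_zero.1 hsummands.2).imp_right hab')
  simp [hla, hla']

theorem mul_log_add_sub_le_mul_log_div {a b r : ℝ} (h : (a, b) ∈ relEntDom) (hr : 0 < r) :
    a * Real.log r + (a - b * r) ≤ a * Real.log (a / b) := by
  obtain ⟨ha, hb, hab⟩ := h
  rcases ha.eq_or_lt' with rfl | ha
  · simpa using mul_nonneg hb hr.le
  · have hb : 0 < b := hb.lt_of_ne' (mt hab ha.ne')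
    have hlog : Real.log (r / (a / b)) ≤ r / (a / b) - 1 :=
      Real.log_le_sub_one_of_pos (div_pos hr (div_pos ha hb))
    rw [Real.log_div hr.ne' (div_pos ha hb).ne'] at hlog
    have hcancel : a * (r / (a / b) - 1) = b * r - a := by field_simp
    linarith [mul_le_mul_of_nonneg_left hlog ha.le]

-- The log-sum inequality: the tangent bounds at the two points are taken at the common slope `A/B`.
theorem convexOn_mul_log_div :
    ConvexOn ℝ relEntDom fun z : ℝ × ℝ => z.1 * Real.log (z.1 / z.2) := by
  refine ⟨convex_relEntDom, ?_⟩
  rintro ⟨a, b⟩ h ⟨a', b'⟩ h' l l' hl hl' hll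
  obtain ⟨hA, hB, hAB⟩ := convex_relEntDom h h' hl hl' hll
  simp only [Prod.smul_mk, Prod.mk_add_mk, smul_eq_mul] at hA hB hAB ⊢
  rcases hA.eq_or_lt' with hA | hA
  · have hsummands :=
      (add_eq_zero_iff_of_nonneg (mul_nonneg hl h.1) (mul_nonneg hl' h'.1)).1 hA
    rw [hA, ← mul_assoc, ← mul_assoc, hsummands.1, hsummands.2]
    simp
  · have hB : 0 < l * b + l' * b' := hB.lt_of_ne' (mt hAB hA.ne')
    have hr := div_pos hA hB
    have htangent := add_le_add
      (mul_le_mul_of_nonneg_left (mul_log_add_sub_le_mul_log_div h hr) hl)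
      (mul_le_mul_of_nonneg_left (mul_log_add_sub_le_mul_log_div h' hr) hl')
    have hcancel := mul_div_cancel₀ (l * a + l' * a') hB.ne'
    linear_combination htangent + hcancel

theorem convexOn_mul_logb_div {b : ℝ} (hb : 1 ≤ b) :
    ConvexOn ℝ relEntDom fun z : ℝ × ℝ => z.1 * Real.logb b (z.1 / z.2) := by
  refine (convexOn_mul_log_div.smul (inv_nonneg.2 (Real.log_nonneg hb))).congr fun z _ => ?_
  simp only [Real.logb, smul_eq_mul]
  ring

theorem convex_programEpigraph {I : Type*} {SΩ : Set (C → ℝ)} (hS : Convex ℝ SΩ) {α : ℝ}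
    (hα : 1 < α) {F : (I → ℝ) → Prop} (hF : Convex ℝ {y | F y}) {f : C → (I → ℝ) → ℝ}
    (hf : ∀ c, IsLinearMap ℝ (f c)) : Convex ℝ (programEpigraph SΩ α F f) := by
  have hr : 0 < 1 / (α - 1) := one_div_pos.2 (sub_pos.2 hα)
  rintro ⟨q, y, z⟩ ⟨hq, hy, hz⟩ ⟨q', y', z'⟩ ⟨hq', hy', hz'⟩ l l' hl hl' hll
  refine ⟨hS hq hq' hl hl' hll, hF hy hy' hl hl' hll, ?_⟩
  obtain ⟨hdom, hz⟩ := (mul_relEnt_le_coe_iff hr _ _ _).1 hz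
  obtain ⟨hdom', hz'⟩ := (mul_relEnt_le_coe_iff hr _ _ _).1 hz'
  rw [mul_relEnt_le_coe_iff hr]
  simp only [Prod.smul_mk, Prod.mk_add_mk, (hf _).map_add, (hf _).map_smul]
  refine ⟨fun c => convex_relEntDom (hdom c) (hdom' c) hl hl' hll, ?_⟩
  have hsum := Finset.sum_le_sum fun c (_ : c ∈ Finset.univ) =>
    (convexOn_mul_logb_div one_le_two).2 (hdom c) (hdom' c) hl hl' hll
  rw [Finset.sum_add_distrib, ← Finset.smul_sum, ← Finset.smul_sum] at hsum
  calc _ ≤ 1 / (α - 1) * (l * ∑ c, q c * Real.logb 2 (q c / f c y)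
          + l' * ∑ c, q' c * Real.logb 2 (q' c / f c y')) := mul_le_mul_of_nonneg_left hsum hr.le
    _ = l * (1 / (α - 1) * ∑ c, q c * Real.logb 2 (q c / f c y))
          + l' * (1 / (α - 1) * ∑ c, q' c * Real.logb 2 (q' c / f c y')) := by ring
    _ ≤ l * z + l' * z' :=
        add_le_add (mul_le_mul_of_nonneg_left hz hl) (mul_le_mul_of_nonneg_left hz' hl')

end RelEnt

section Value

variable {X Y A B C : Type*} [Fintype X] [Fintype Y] [Fintype A] [Fintype B] [Fintype C]
  [DecidableEq X] [DecidableEq Y] [DecidableEq A] [DecidableEq B] [DecidableEq C]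

theorem NPARelaxation.programValue_le {S : Protocol X Y A B C} {SΩ : Set (C → ℝ)} {α : ℝ}
    (hα : α ∈ Set.Ioo (1 : ℝ) 2) {m : ℕ} {nd w : Fin m → ℝ} (h : IsGaussRadauJacobi α m nd w)
    (R : NPARelaxation S α nd w) :
    programValue SΩ α (fun y : R.Idx → ℝ => y R.one = 1 ∧ (R.momentMatrix y).PosSemidef)
      (fun c y => R.riesz y (objective S α nd w c)) ≤ singleRoundValue S SΩ α := by
  have hr : 0 ≤ 1 / (α - 1) := one_div_nonneg.2 (sub_nonneg.2 hα.1.le)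
  refine le_iInf fun dA => le_iInf fun dB => le_iInf fun dE => le_iInf fun D =>
    le_iInf₂ fun q hq => le_iInf₂ fun σ hσ => ?_
  obtain ⟨Z, hZ⟩ := exists_petz_le_expect D hσ.1 hα h
  refine iInf₂_le_of_le q hq (iInf₂_le_of_le (R.moments D Z σ)
    ⟨R.moments_one D Z hσ, R.posSemidef_momentMatrix_moments D Z hσ.1⟩ ?_)
  refine mul_le_mul_of_nonneg_left (antitone_relEnt q fun c => ?_) (EReal.coe_nonneg.2 hr)
  exact (hZ c).trans_eq (R.riesz_moments D Z σ (R.objective_mono c)).symm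

end Value

end DIRenyi

end

open DIRenyi in
theorem theorem6 {X Y A B C : Type*} [Fintype X] [Fintype Y] [Fintype A] [Fintype B] [Fintype C]
    [DecidableEq X] [DecidableEq Y] [DecidableEq A] [DecidableEq B] [DecidableEq C]
    (S : Protocol X Y A B C) (SΩ : Set (C → ℝ)) (hΩ : SΩ ⊆ stdSimplex ℝ C)
    (α : ℝ) (hα : α ∈ Set.Ioo (1 : ℝ) 2) (m : ℕ) (hm : 1 ≤ m) :
    ∃ nd w : Fin m → ℝ, IsGaussRadauJacobi α m nd w ∧
      ∀ R : NPARelaxation S α nd w,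
        ∃ (a : R.Idx → C → ℝ) (E : R.Idx → Matrix R.Row R.Row ℝ),
          (∀ (y : R.Idx → ℝ) (c : C), ∑ i, a i c * y i = R.riesz y (objective S α nd w c)) ∧
          (∀ y : R.Idx → ℝ, R.momentMatrix y = ∑ i, y i • E i) ∧
          programValue SΩ α
              (fun y : R.Idx → ℝ => y R.one = 1 ∧ (∑ i, y i • E i).PosSemidef)
              (fun c y => ∑ i, a i c * y i)
            ≤ singleRoundValue S SΩ α ∧
          (Convex ℝ SΩ →
            Convex ℝ (programEpigraph SΩ α
              (fun y : R.Idx → ℝ => y R.one = 1 ∧ (∑ i, y i • E i).PosSemidef)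
              (fun c y => ∑ i, a i c * y i))) := by
  obtain ⟨nd, w, h⟩ := exists_isGaussRadauJacobi hα hm
  refine ⟨nd, w, h, fun R => ⟨fun i c => (objective S α nd w c).coeff i.1, R.coeffMatrix,
    fun _ _ => rfl, R.momentMatrix_eq_sum, ?_, fun hS => ?_⟩⟩
  · simp only [← R.momentMatrix_eq_sum]
    exact R.programValue_le hα h
  · simp only [← R.momentMatrix_eq_sum]
    exact convex_programEpigraph hS hα.1 R.convex_feasible fun c => R.isLinearMap_riesz _
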